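/- Let $n\ge 2$, let $\overline g$ be the round metric on the unit sphere $\mathbb S^n\subset\mathbb R^{n+1}$, and write $dV_h$ for the volume element of a Riemannian metric $h$. An equator is a set $\{x\in\mathbb S^n:\langle x,v\rangle=0\}$ with $v\neq 0$. Let $\mathcal E(\mathbb S^n)$ be the set of smooth Riemannian metrics on $\mathbb S^n$ with respect to which all equators are minimal hypersurfaces. Let $\mathcal K_2(\mathbb S^n,\overline g)$ be the vector space of smooth symmetric two-tensors $k$ on $\mathbb S^n$ that are Killing, i.e. such that $k(\gamma',\gamma')$ is constant along every geodesic $\gamma$ of $\overline g$, and let $\mathcal K_2^+(\mathbb S^n,\overline g)$ be its subset of positive definite tensors. For $g\in\mathcal E(\mathbb S^n)$ put $k_g=\frac1{F_g}g$, where $dV_g=F_g^{(n+1)/4}\,dV_{\overline g}$; for $k\in\mathcal K_2^+(\mathbb S^n,\overline g)$ put $g_k=\frac1{D_k}k$, where $dV_k=D_k^{(n-1)/4}\,dV_{\overline g}$. For $T\in GL(n+1,\mathbb R)$ let $\phi(T):\mathbb S^n\to\mathbb S^n$, $\phi(T)(x)=Tx/|Tx|$. A skew-symmetric matrix $V$ of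 size $n+1$ is identified with the Killing vector field $p\mapsto Vp$ of $\overline g$; for skew-symmetric $V,W$ let $$(V\odot W)_p(x,y)=\langle Vp,x\rangle\langle Wp,y\rangle+\langle Vp,y\rangle\langle Wp,x\rangle\in\mathcal K_2(\mathbb S^n,\overline g),\qquad V\cdot T=|\det T|^{-\frac{2}{n+1}}\,T^{\top}VT .$$ Theorem. The maps $g\mapsto k_g$ and $k\mapsto g_k$ are mutually inverse bijections between $\mathcal E(\mathbb S^n)$ and $\mathcal K_2^+(\mathbb S^n,\overline g)$. The rule $g\cdot T=\phi(T)^*g$ defines a right action of $GL(n+1,\mathbb R)$ on $\mathcal E(\mathbb S^n)$. For every $T\in GL(n+1,\mathbb R)$ there is a unique linear map $k\mapsto k\cdot T$ of $\mathcal K_2(\mathbb S^n,\overline g)$ into itself with $$(V\odot W)\cdot T=(V\cdot T)\odot(W\cdot T)=|\det T|^{-\frac{4}{n+1}}\,(T^\top VT)\odot(T^\top WT)\qquad\text{for all skew-symmetric }V,W,$$ and these maps form a right linear action of $GL(n+1,\mathbb R)$ on $\mathcal K_2(\mathbb S^n,\overline g)$ which preserves $\mathcal K_2^+(\mathbb S^n,\overline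 g)$. The correspondence is equivariant with respect to these actions: $$k_{\phi(T)^*g}=k_g\cdot T\qquad\text{for all } g\in\mathcal E(\mathbb S^n),\ T\in GL(n+1,\mathbb R).$$ -/

import Mathlib

open scoped Matrix ContDiff

noncomputable section

namespace Equators

/-- The Euclidean space `ℝ^{n+1}`. -/
abbrev Amb (n : ℕ) : Type := EuclideanSpace ℝ (Fin (n + 1))

/-- The unit sphere `S^n` in `ℝ^{n+1}`.  Its tangent space at `p` is `{w | ⟪p, w⟫ = 0}`. -/
abbrev Sphere (n : ℕ) : Type := Metric.sphere (0 : Amb n) 1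

/-- The radial projection `x ↦ x / |x|` of `ℝ^{n+1} \ {0}` onto the sphere. -/
def radialProj {n : ℕ} (x : Amb n) (hx : x ≠ 0) : Sphere n :=
  ⟨‖x‖⁻¹ • x, by
    rw [mem_sphere_zero_iff_norm, norm_smul, norm_inv, norm_norm,
      inv_mul_cancel₀ (norm_ne_zero_iff.mpr hx)]⟩

open Classical in
/-- The extension of a map on the sphere which is constant along rays (with value `0` at the
origin).  A map `f` on the sphere is smooth if and only if `radialExt f` is smooth on
`ℝ^{n+1} \ {0}`, and for `w` tangent to the sphere at `p` the vector `fderiv ℝ (radialExt f) p w`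
is the derivative of `f` at `p` in the direction `w`. -/
def radialExt {n : ℕ} {F : Type*} [Zero F] (f : Sphere n → F) (x : Amb n) : F :=
  if hx : x = 0 then 0 else f (radialProj x hx)

/-- Smoothness of a map from the sphere to a normed space. -/
def SmoothOnSphere {n : ℕ} {F : Type*} [NormedAddCommGroup F] [NormedSpace ℝ F]
    (f : Sphere n → F) : Prop :=
  ContDiffOn ℝ ∞ (radialExt f) {0}ᶜ

/-- The derivative at `p` of a map from the sphere to a normed space, in the direction `w` (which
is only used for `w` tangent at `p`). -/
def dirDeriv {n : ℕ} {F : Type*} [NormedAddCommGroup F] [NormedSpace ℝ F]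
    (f : Sphere n → F) (p : Sphere n) (w : Amb n) : F :=
  fderiv ℝ (radialExt f) (p : Amb n) w

/-! ### Symmetric two-tensors on the sphere -/

/-- Fields of bilinear forms on the ambient space along the sphere.  A two-tensor on the sphere is
represented by the one whose value at `p` is the extension by zero, along the normal line `ℝ p`,
of the given bilinear form on the tangent space at `p`; see `IsSymTensor`. -/
abbrev BilinField (n : ℕ) : Type := Sphere n → (Amb n →L[ℝ] Amb n →L[ℝ] ℝ)

/-- `h` is (the extension by zero along normals of) a smooth symmetric two-tensor on `S^n`. -/
structure IsSymTensor {n : ℕ} (h : BilinField n) : Prop where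
  smooth : SmoothOnSphere h
  symm : ∀ p x y, h p x y = h p y x
  horizontal : ∀ (p : Sphere n) y, h p (p : Amb n) y = 0

/-- `h` is positive definite on every tangent space of the sphere. -/
def IsPosDef {n : ℕ} (h : BilinField n) : Prop :=
  ∀ (p : Sphere n) (w : Amb n), inner ℝ (p : Amb n) w = 0 → w ≠ 0 → 0 < h p w w

/-- Riemannian metrics on `S^n`. -/
def IsRiemannianMetric {n : ℕ} (g : BilinField n) : Prop :=
  IsSymTensor g ∧ IsPosDef g

/-- The differential at `p` of a map `φ` of the sphere to itself. -/
def sphereDeriv {n : ℕ} (φ : Sphere n → Sphere n) (p : Sphere n) : Amb n →L[ℝ] Amb n :=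
  fderiv ℝ (radialExt fun q => (φ q : Amb n)) (p : Amb n)

/-- The pull-back `φ^* h`, that is, `(φ^* h)_p(x, y) = h_{φ(p)}(dφ_p x, dφ_p y)`.  (The normal
vector `p` is in the kernel of `sphereDeriv φ p`.) -/
def pullback {n : ℕ} (φ : Sphere n → Sphere n) (h : BilinField n) : BilinField n :=
  fun p => (h (φ p)).bilinearComp (sphereDeriv φ p) (sphereDeriv φ p)

/-! ### Killing symmetric two-tensors of the round sphere -/

/-- The geodesic `t ↦ cos t p + sin t w` of the round sphere, where `w` is a unit tangent vector
at `p`. -/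
def geodesic {n : ℕ} (p : Sphere n) (w : Amb n) (hw : ‖w‖ = 1) (hpw : inner ℝ (p : Amb n) w = 0)
    (t : ℝ) : Sphere n :=
  ⟨Real.cos t • (p : Amb n) + Real.sin t • w, by
    have hp : ‖(p : Amb n)‖ = 1 := mem_sphere_zero_iff_norm.mp p.2
    rw [mem_sphere_zero_iff_norm, ← sq_eq_sq₀ (norm_nonneg _) zero_le_one, norm_add_sq_real,
      norm_smul, norm_smul, inner_smul_left, inner_smul_right, hpw, hp, hw]
    simp [sq_abs]⟩

/-- The velocity of the geodesic `t ↦ cos t p + sin t w`. -/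
def velocity {n : ℕ} (p : Sphere n) (w : Amb n) (t : ℝ) : Amb n :=
  -Real.sin t • (p : Amb n) + Real.cos t • w

/-- The symmetric tensor `k` is constant along all geodesics of the round sphere. -/
def IsConstAlongGeodesics {n : ℕ} (k : BilinField n) : Prop :=
  ∀ (p : Sphere n) (w : Amb n) (hw : ‖w‖ = 1) (hpw : inner ℝ (p : Amb n) w = 0) (s t : ℝ),
    k (geodesic p w hw hpw s) (velocity p w s) (velocity p w s) =
      k (geodesic p w hw hpw t) (velocity p w t) (velocity p w t)

theorem radialExt_add {n : ℕ} {F : Type*} [NormedAddCommGroup F]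
    (f g : Sphere n → F) : radialExt (f + g) = radialExt f + radialExt g := by
  funext x
  by_cases hx : x = 0 <;> simp [radialExt, hx]

theorem radialExt_smul {n : ℕ} {F : Type*} [NormedAddCommGroup F]
    [NormedSpace ℝ F] (c : ℝ) (f : Sphere n → F) : radialExt (c • f) = c • radialExt f := by
  funext x
  by_cases hx : x = 0 <;> simp [radialExt, hx]

/-- The real vector space `𝒦₂(S^n, ḡ)` of the Killing symmetric two-tensors of the round
sphere. -/
def killingTensors (n : ℕ) : Submodule ℝ (BilinField n) where
  carrier := {k | IsSymTensor k ∧ IsConstAlongGeodesics k}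
  add_mem' := by
    rintro a b ⟨ha, ha'⟩ ⟨hb, hb'⟩
    refine ⟨⟨?_, ?_, ?_⟩, ?_⟩
    · unfold SmoothOnSphere
      have h := radialExt_add a b
      rw [h]
      exact ha.smooth.add hb.smooth
    · intro p x y
      simp [ha.symm p x y, hb.symm p x y]
    · intro p y
      simp [ha.horizontal, hb.horizontal]
    · intro p w hw hpw s t
      simp [ha' p w hw hpw s t, hb' p w hw hpw s t]
  zero_mem' := by
    refine ⟨⟨?_, ?_, ?_⟩, ?_⟩
    · have h0 : radialExt (0 : BilinField n) = fun _ => 0 := by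
        funext x
        by_cases hx : x = 0 <;> simp [radialExt, hx]
      unfold SmoothOnSphere
      rw [h0]
      exact contDiffOn_const
    · intro p x y
      simp
    · intro p y
      simp
    · intro p w hw hpw s t
      simp
  smul_mem' := by
    rintro c a ⟨ha, ha'⟩
    refine ⟨⟨?_, ?_, ?_⟩, ?_⟩
    · unfold SmoothOnSphere
      have h := radialExt_smul c a
      rw [h]
      exact ha.smooth.const_smul c
    · intro p x y
      simp [ha.symm p x y]
    · intro p y
      simp [ha.horizontal]
    · intro p w hw hpw s t
      simp [ha' p w hw hpw s t]

/-- The set `𝒦₂⁺(S^n, ḡ)` of the positive definite Killing symmetric two-tensors. -/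
def posKillingTensors (n : ℕ) : Set (BilinField n) :=
  {k | k ∈ killingTensors n ∧ IsPosDef k}

/-! ### Metrics with minimal equators -/

/-- The vector `u` tangent to the sphere at `p` with `g_p(u, z) = α(z)` for all `z` tangent at
`p`. -/
def sharp {n : ℕ} (g : BilinField n) (p : Sphere n) (α : Amb n → ℝ) : Amb n :=
  Classical.epsilon fun u => inner ℝ (p : Amb n) u = 0 ∧
    ∀ z, inner ℝ (p : Amb n) z = 0 → g p u z = α z

/-- The orthogonal projection of `y` onto the tangent space at `p`. -/
def tangentProj {n : ℕ} (p : Sphere n) (y : Amb n) : Amb n :=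
  y - (inner ℝ (p : Amb n) y) • (p : Amb n)

/-- The Levi-Civita connection of the round metric: `∇̄_w Y` at `p`, for `w` tangent at `p`. -/
def roundConn {n : ℕ} (p : Sphere n) (w : Amb n) (Y : Sphere n → Amb n) : Amb n :=
  tangentProj p (dirDeriv Y p w)

/-- The difference `∇^g - ∇̄` of the Levi-Civita connections of `g` and of the round metric at `p`,
evaluated at tangent vectors `x`, `y`: it is given by the Koszul formula
`2 g(∇^g_x y - ∇̄_x y, z) = (∇̄_x g)(y, z) + (∇̄_y g)(x, z) - (∇̄_z g)(x, y)`.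
(Since `g` is extended by zero along normals, `(∇̄_x g)(y, z)` is the plain derivative of `g` in the
direction `x`, evaluated at the tangent vectors `y`, `z`.) -/
def connDiff {n : ℕ} (g : BilinField n) (p : Sphere n) (x y : Amb n) : Amb n :=
  sharp g p fun z =>
    (dirDeriv g p x y z + dirDeriv g p y x z - dirDeriv g p z x y) / 2

/-- The Levi-Civita connection of `g`: the vector `∇^g_w Y` at `p`, for `w` tangent at `p` and `Y` a
vector field tangent to the sphere.  See `leviCivita_torsionFree` and `leviCivita_metric`. -/
def leviCivita {n : ℕ} (g : BilinField n) (p : Sphere n) (w : Amb n) (Y : Sphere n → Amb n) :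
    Amb n :=
  roundConn p w Y + connDiff g p w (Y p)

/-- The gradient with respect to `g` of the height function `p ↦ ⟪v, p⟫` on the sphere. -/
def gradHeight {n : ℕ} (g : BilinField n) (v : Amb n) (p : Sphere n) : Amb n :=
  sharp g p fun z => inner ℝ v z

/-- The unit normal field `∇^g V / |∇^g V|_g`, where `V` is the height function `p ↦ ⟪v, p⟫`. -/
def unitNormal {n : ℕ} (g : BilinField n) (v : Amb n) (p : Sphere n) : Amb n :=
  (Real.sqrt (g p (gradHeight g v p) (gradHeight g v p)))⁻¹ • gradHeight g v p

/-- The second fundamental form `A(x, y) = g(∇^g_x N, y)` of the equator orthogonal to `v`. -/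
def secondFundForm {n : ℕ} (g : BilinField n) (v : Amb n) (p : Sphere n) (x y : Amb n) : ℝ :=
  g p (leviCivita g p x (unitNormal g v)) y

/-- The equator `{p | ⟪v, p⟫ = 0}` is a minimal hypersurface with respect to the metric `g`: at each
of its points the mean curvature, that is, the trace of the second fundamental form in a
`g`-orthonormal basis of the tangent space `{w | ⟪p, w⟫ = ⟪v, w⟫ = 0}` of the equator,
vanishes. -/
def IsMinimalEquator {n : ℕ} (g : BilinField n) (v : Amb n) : Prop :=
  ∀ p : Sphere n, inner ℝ v (p : Amb n) = 0 →
    ∀ e : Fin (n - 1) → Amb n,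
      (∀ i, inner ℝ (p : Amb n) (e i) = 0 ∧ inner ℝ v (e i) = 0) →
      (∀ i j, g p (e i) (e j) = if i = j then 1 else 0) →
      ∑ i, secondFundForm g v p (e i) (e i) = 0

/-- The set `ℰ(S^n)` of the Riemannian metrics on `S^n` with respect to which all equators are
minimal. -/
def minimalEquatorMetrics (n : ℕ) : Set (BilinField n) :=
  {g | IsRiemannianMetric g ∧ ∀ v : Amb n, v ≠ 0 → IsMinimalEquator g v}

/-! ### The correspondence -/

/-- The density `dV_h / dV_ḡ` at `p` of the volume element of `h` with respect to the volume
element of the round metric: the square root of the determinant of the Gram matrix of `h` in an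
orthonormal basis (for the round metric) of the tangent space at `p`. -/
def volDensity {n : ℕ} (h : BilinField n) (p : Sphere n) : ℝ :=
  let b := stdOrthonormalBasis ℝ (Submodule.span ℝ {(p : Amb n)})ᗮ
  Real.sqrt (Matrix.of fun i j => h p (b i : Amb n) (b j : Amb n)).det

/-- The function `F_g` with `dV_g = F_g^{(n+1)/4} dV_ḡ`. -/
def metricFactor {n : ℕ} (g : BilinField n) (p : Sphere n) : ℝ :=
  volDensity g p ^ (4 / ((n : ℝ) + 1))

/-- The function `D_k` with `dV_k = D_k^{(n-1)/4} dV_ḡ`. -/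
def killingFactor {n : ℕ} (k : BilinField n) (p : Sphere n) : ℝ :=
  volDensity k p ^ (4 / ((n : ℝ) - 1))

/-- The tensor `k_g = (1 / F_g) g`. -/
def toKilling {n : ℕ} (g : BilinField n) : BilinField n :=
  fun p => (metricFactor g p)⁻¹ • g p

/-- The tensor `g_k = (1 / D_k) k`. -/
def toMetric {n : ℕ} (k : BilinField n) : BilinField n :=
  fun p => (killingFactor k p)⁻¹ • k p

/-! ### The actions of the general linear group -/

/-- The general linear group `GL(n+1, ℝ)`. -/
abbrev GLn (n : ℕ) : Type := GL (Fin (n + 1)) ℝ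

/-- The linear map of `ℝ^{n+1}` with matrix `M`. -/
abbrev act {n : ℕ} (M : Matrix (Fin (n + 1)) (Fin (n + 1)) ℝ) : Amb n →L[ℝ] Amb n :=
  Matrix.toEuclideanCLM (n := Fin (n + 1)) (𝕜 := ℝ) M

theorem act_ne_zero {n : ℕ} (T : GLn n) (p : Sphere n) :
    act (T : Matrix (Fin (n + 1)) (Fin (n + 1)) ℝ) (p : Amb n) ≠ 0 := by
  intro h
  have h1 : act ((T⁻¹ : GLn n) : Matrix (Fin (n + 1)) (Fin (n + 1)) ℝ)
      (act (T : Matrix (Fin (n + 1)) (Fin (n + 1)) ℝ) (p : Amb n)) = p := by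
    rw [← mul_apply_eq_comp, ← map_mul, ← Units.val_mul, inv_mul_cancel]
    simp
  rw [h, map_zero] at h1
  have hp : ‖(p : Amb n)‖ = 1 := mem_sphere_zero_iff_norm.mp p.2
  rw [← h1] at hp
  simp at hp

/-- The diffeomorphism `φ(T) : x ↦ T x / |T x|` of the sphere. -/
def phi {n : ℕ} (T : GLn n) (x : Sphere n) : Sphere n :=
  radialProj (act (T : Matrix (Fin (n + 1)) (Fin (n + 1)) ℝ) (x : Amb n)) (act_ne_zero T x)

/-- The skew-symmetric matrices, that is, the elements of `𝔰𝔬(n+1, ℝ)`.  The matrix `V` corresponds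
to the Killing vector field `p ↦ V p` of the round sphere. -/
abbrev son (n : ℕ) : Type := {V : Matrix (Fin (n + 1)) (Fin (n + 1)) ℝ // Vᵀ = -V}

/-- The right action `V · T = |det T|^{-2/(n+1)} Tᵀ V T` of the general linear group on Killing
vector fields. -/
def soAct {n : ℕ} (V : son n) (T : GLn n) : son n :=
  ⟨(|(T : Matrix (Fin (n + 1)) (Fin (n + 1)) ℝ).det| ^ (-(2 / ((n : ℝ) + 1)))) •
      ((T : Matrix (Fin (n + 1)) (Fin (n + 1)) ℝ)ᵀ * V.1 *
        (T : Matrix (Fin (n + 1)) (Fin (n + 1)) ℝ)), by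
    have hV := V.2
    simp [Matrix.transpose_mul, hV, Matrix.mul_assoc]⟩

/-- The symmetric product `V ⊙ W` of the Killing fields of `V` and `W`, that is,
`(V ⊙ W)_p(x, y) = ⟪V p, x⟫ ⟪W p, y⟫ + ⟪V p, y⟫ ⟪W p, x⟫`. -/
def symProd {n : ℕ} (V W : son n) : BilinField n := fun p =>
  (innerSL ℝ (act V.1 (p : Amb n))).smulRight (innerSL ℝ (act W.1 (p : Amb n))) +
    (innerSL ℝ (act W.1 (p : Amb n))).smulRight (innerSL ℝ (act V.1 (p : Amb n)))

theorem symProd_apply {n : ℕ} (V W : son n) (p : Sphere n) (x y : Amb n) :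
    symProd V W p x y =
      inner ℝ (act V.1 (p : Amb n)) x * inner ℝ (act W.1 (p : Amb n)) y +
        inner ℝ (act V.1 (p : Amb n)) y * inner ℝ (act W.1 (p : Amb n)) x := by
  simp [symProd]
  ring

theorem inner_act_swap {n : ℕ} (V : son n) (x y : Amb n) :
    inner ℝ (act V.1 x) y = -inner ℝ (act V.1 y) x := by
  have hV := V.2
  have hs : star V.1 = -V.1 := by
    rw [Matrix.star_eq_conjTranspose, Matrix.conjTranspose_eq_transpose_of_trivial, hV]
  have h2 : ContinuousLinearMap.adjoint (act V.1) = -act V.1 := by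
    rw [← ContinuousLinearMap.star_eq_adjoint]
    unfold act
    rw [← map_star, hs, map_neg]
  rw [real_inner_comm, ← ContinuousLinearMap.adjoint_inner_left, h2]
  simp

theorem inner_act_self {n : ℕ} (V : son n) (x : Amb n) : inner ℝ (act V.1 x) x = 0 := by
  have h := inner_act_swap V x x
  linarith

theorem inner_act_geodesic {n : ℕ} (V : son n) (p : Sphere n) (w : Amb n) (hw : ‖w‖ = 1)
    (hpw : inner ℝ (p : Amb n) w = 0) (t : ℝ) :
    inner ℝ (act V.1 (geodesic p w hw hpw t : Amb n)) (velocity p w t) =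
      inner ℝ (act V.1 (p : Amb n)) w := by
  have h1 := inner_act_self V (p : Amb n)
  have h2 := inner_act_self V w
  have h3 := inner_act_swap V w (p : Amb n)
  have h4 := Real.sin_sq_add_cos_sq t
  simp only [geodesic, velocity, map_add, map_smul, inner_add_left, inner_add_right,
    real_inner_smul_left, real_inner_smul_right, h1, h2, h3]
  linear_combination (inner ℝ (act V.1 (p : Amb n)) w) * h4

theorem symProd_mem {n : ℕ} (V W : son n) : symProd V W ∈ killingTensors n := by
  refine ⟨⟨?_, ?_, ?_⟩, ?_⟩
  · have hP : ∀ U : son n, ContDiffOn ℝ ∞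
        (fun x : Amb n => innerSL ℝ (act U.1 (‖x‖⁻¹ • x))) {0}ᶜ := by
      intro U x hx
      have hx' : x ≠ 0 := hx
      have hn : ContDiffAt ℝ ∞ (fun y : Amb n => ‖y‖⁻¹ • y) x :=
        ((contDiffAt_norm ℝ hx').inv (norm_ne_zero_iff.mpr hx')).smul contDiffAt_id
      exact (((innerSL ℝ (E := Amb n)).contDiff.contDiffAt.comp x
        ((act U.1).contDiff.contDiffAt.comp x hn))).contDiffWithinAt
    have hS : ∀ U U' : son n, ContDiffOn ℝ ∞
        (fun x : Amb n => (innerSL ℝ (act U.1 (‖x‖⁻¹ • x))).smulRight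
          (innerSL ℝ (act U'.1 (‖x‖⁻¹ • x)))) {0}ᶜ := fun U U' =>
      (hP U).smulRight (hP U')
    refine ((hS V W).add (hS W V)).congr ?_
    intro x hx
    have hx' : x ≠ 0 := hx
    simp [radialExt, hx', symProd, radialProj]
  · intro p x y
    rw [symProd_apply, symProd_apply]
    ring
  · intro p y
    rw [symProd_apply, inner_act_self, inner_act_self]
    ring
  · intro p w hw hpw s t
    simp only [symProd_apply, inner_act_geodesic]

/-- The symmetric product `V ⊙ W`, as a Killing symmetric two-tensor. -/
def killingProd {n : ℕ} (V W : son n) : killingTensors n := ⟨symProd V W, symProd_mem V W⟩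

/-! ### The defining properties of the Levi-Civita connection -/

theorem sharp_spec {n : ℕ} {g : BilinField n} (hg : IsRiemannianMetric g) (p : Sphere n)
    (α : Amb n →ₗ[ℝ] ℝ) : inner ℝ (p : Amb n) (sharp g p α) = 0 ∧
      ∀ z, inner ℝ (p : Amb n) z = 0 → g p (sharp g p α) z = α z := by
  have hp : ‖(p : Amb n)‖ = 1 := mem_sphere_zero_iff_norm.mp p.2
  refine Classical.epsilon_spec (p := fun u => inner ℝ (p : Amb n) u = 0 ∧
    ∀ z, inner ℝ (p : Amb n) z = 0 → g p u z = α z) ?_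
  let B : Amb n →ₗ[ℝ] (Module.Dual ℝ (Amb n)) :=
    (ContinuousLinearMap.coeLM ℝ).comp (g p).toLinearMap +
      ((innerSL ℝ (p : Amb n)).toLinearMap).smulRight (innerSL ℝ (p : Amb n)).toLinearMap
  have hB : ∀ x y, B x y = g p x y + inner ℝ (p : Amb n) x * inner ℝ (p : Amb n) y := by
    intro x y
    simp [B]
  have hpp : inner ℝ (p : Amb n) (p : Amb n) = (1 : ℝ) := by
    rw [real_inner_self_eq_norm_sq, hp]
    norm_num
  have hh : ∀ y, g p y (p : Amb n) = 0 := fun y => by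
    rw [hg.1.symm, hg.1.horizontal]
  have inj : Function.Injective B := by
    rw [← LinearMap.ker_eq_bot, LinearMap.ker_eq_bot']
    intro x hx
    have h1 : B x p = 0 := by rw [hx]; rfl
    rw [hB, hh, hpp] at h1
    have h1' : inner ℝ (p : Amb n) x = 0 := by linarith
    have h2 : B x x = 0 := by rw [hx]; rfl
    rw [hB, h1'] at h2
    by_contra hne
    have h3 := hg.2 p x h1' hne
    linarith
  have surj : Function.Surjective B :=
    (LinearMap.injective_iff_surjective_of_finrank_eq_finrank
      (Subspace.dual_finrank_eq (K := ℝ) (V := Amb n)).symm).mp inj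
  obtain ⟨u, hu⟩ := surj (α - (α (p : Amb n)) • (innerSL ℝ (p : Amb n)).toLinearMap)
  have hu1 : inner ℝ (p : Amb n) u = 0 := by
    have h := congrArg (fun f => f (p : Amb n)) hu
    simp only [hB, hh, hpp] at h
    simpa [hp] using h
  refine ⟨u, hu1, fun z hz => ?_⟩
  have h := congrArg (fun f => f z) hu
  simp only [hB] at h
  simpa [hz] using h

theorem differentiableAt_radialExt {n : ℕ} {F : Type*} [NormedAddCommGroup F] [NormedSpace ℝ F]
    {f : Sphere n → F} (hf : SmoothOnSphere f) (p : Sphere n) :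
    DifferentiableAt ℝ (radialExt f) (p : Amb n) := by
  have hp : (p : Amb n) ∈ ({0}ᶜ : Set (Amb n)) := by
    intro h
    have hn : ‖(p : Amb n)‖ = 1 := mem_sphere_zero_iff_norm.mp p.2
    rw [Set.mem_singleton_iff.mp h] at hn
    simp at hn
  exact (hf.contDiffAt (isOpen_compl_singleton.mem_nhds hp)).differentiableAt (by simp)

theorem radialExt_coe {n : ℕ} {F : Type*} [Zero F] (f : Sphere n → F) (p : Sphere n) :
    radialExt f (p : Amb n) = f p := by
  have hn : ‖(p : Amb n)‖ = 1 := mem_sphere_zero_iff_norm.mp p.2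
  have hp : (p : Amb n) ≠ 0 := by
    intro h
    rw [h] at hn
    simp at hn
  have h2 : radialProj (p : Amb n) hp = p := by
    apply Subtype.ext
    simp [radialProj]
  rw [radialExt, dif_neg hp, h2]

theorem dirDeriv_symm {n : ℕ} {g : BilinField n} (hg : IsSymTensor g) (p : Sphere n)
    (w x y : Amb n) : dirDeriv g p w x y = dirDeriv g p w y x := by
  have hd := (differentiableAt_radialExt hg.smooth p).hasFDerivAt
  have h1 := (hd.clm_apply (hasFDerivAt_const x (p : Amb n))).clm_apply
    (hasFDerivAt_const y (p : Amb n))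
  have h2 := (hd.clm_apply (hasFDerivAt_const y (p : Amb n))).clm_apply
    (hasFDerivAt_const x (p : Amb n))
  have he : (fun q : Amb n => radialExt g q x y) = fun q : Amb n => radialExt g q y x := by
    funext q
    by_cases hq : q = 0
    · simp [radialExt, hq]
    · simp only [radialExt, dif_neg hq]
      exact hg.symm _ x y
  rw [he] at h1
  have h3 := congrArg (fun L : Amb n →L[ℝ] ℝ => L w) (h1.unique h2)
  simpa [dirDeriv] using h3

theorem connDiff_spec {n : ℕ} {g : BilinField n} (hg : IsRiemannianMetric g) (p : Sphere n)
    (x y : Amb n) : inner ℝ (p : Amb n) (connDiff g p x y) = 0 ∧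
      ∀ z, inner ℝ (p : Amb n) z = 0 → g p (connDiff g p x y) z =
        (dirDeriv g p x y z + dirDeriv g p y x z - dirDeriv g p z x y) / 2 := by
  let α : Amb n →ₗ[ℝ] ℝ :=
    { toFun := fun z => (dirDeriv g p x y z + dirDeriv g p y x z - dirDeriv g p z x y) / 2
      map_add' := fun a b => by
        simp only [dirDeriv, map_add, add_apply]
        ring
      map_smul' := fun c a => by
        simp only [dirDeriv, map_smul, smul_apply, smul_eq_mul,
          RingHom.id_apply]
        ring }
  exact sharp_spec hg p α

/-- The connection `∇^g` is torsion free: `∇^g_X Y - ∇^g_Y X` is the Lie bracket of `X` and `Y`. -/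
theorem leviCivita_torsionFree {n : ℕ} {g : BilinField n} (hg : IsRiemannianMetric g)
    {X Y : Sphere n → Amb n} (hX : SmoothOnSphere X) (hY : SmoothOnSphere Y)
    (tX : ∀ p : Sphere n, inner ℝ (p : Amb n) (X p) = 0)
    (tY : ∀ p : Sphere n, inner ℝ (p : Amb n) (Y p) = 0) (p : Sphere n) :
    leviCivita g p (X p) Y - leviCivita g p (Y p) X =
      VectorField.lieBracket ℝ (radialExt X) (radialExt Y) (p : Amb n) := by
  have dX := (differentiableAt_radialExt hX p).hasFDerivAt
  have dY := (differentiableAt_radialExt hY p).hasFDerivAt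
  have key : ∀ {U : Sphere n → Amb n}, (∀ p : Sphere n, inner ℝ (p : Amb n) (U p) = 0) →
      HasFDerivAt (radialExt U) (fderiv ℝ (radialExt U) (p : Amb n)) (p : Amb n) →
      ∀ w, inner ℝ (p : Amb n) (dirDeriv U p w) = -inner ℝ w (U p) := by
    intro U tU dU w
    have h := (hasFDerivAt_id (𝕜 := ℝ) (p : Amb n)).inner ℝ dU
    have he : (fun x : Amb n => inner ℝ (id x) (radialExt U x)) = fun _ => (0 : ℝ) := by
      funext x
      by_cases hx : x = 0
      · simp [radialExt, hx]
      · simp only [radialExt, dif_neg hx, id]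
        have h1 := tU (radialProj x hx)
        simp only [radialProj, real_inner_smul_left] at h1
        exact (mul_eq_zero.mp h1).resolve_left (inv_ne_zero (norm_ne_zero_iff.mpr hx))
    rw [he] at h
    have h3 := congrArg (fun L : Amb n →L[ℝ] ℝ => L w)
      (h.unique (hasFDerivAt_const (0 : ℝ) (p : Amb n)))
    simp [radialExt_coe] at h3
    simp only [dirDeriv]
    linarith
  have hsym : connDiff g p (X p) (Y p) = connDiff g p (Y p) (X p) := by
    unfold connDiff
    congr 1
    funext z
    rw [dirDeriv_symm hg.1 p z (X p) (Y p)]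
    ring
  have e1 := key tX dX (Y p)
  have e2 := key tY dY (X p)
  unfold leviCivita roundConn tangentProj
  rw [hsym, e1, e2, VectorField.lieBracket, radialExt_coe, radialExt_coe, real_inner_comm (Y p) (X p)]
  simp only [dirDeriv]
  abel

/-- The connection `∇^g` is compatible with `g`:
`X g(Y, Z) = g(∇^g_X Y, Z) + g(Y, ∇^g_X Z)`. -/
theorem leviCivita_metric {n : ℕ} {g : BilinField n} (hg : IsRiemannianMetric g)
    {Y Z : Sphere n → Amb n} (hY : SmoothOnSphere Y) (hZ : SmoothOnSphere Z)
    (tY : ∀ p : Sphere n, inner ℝ (p : Amb n) (Y p) = 0)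
    (tZ : ∀ p : Sphere n, inner ℝ (p : Amb n) (Z p) = 0) (p : Sphere n) (w : Amb n) :
    dirDeriv (fun q => g q (Y q) (Z q)) p w =
      g p (leviCivita g p w Y) (Z p) + g p (Y p) (leviCivita g p w Z) := by
  have dg := (differentiableAt_radialExt hg.1.smooth p).hasFDerivAt
  have dY := (differentiableAt_radialExt hY p).hasFDerivAt
  have dZ := (differentiableAt_radialExt hZ p).hasFDerivAt
  have he : (radialExt fun q => g q (Y q) (Z q)) =
      fun x => radialExt g x (radialExt Y x) (radialExt Z x) := by
    funext x
    by_cases hx : x = 0 <;> simp [radialExt, hx]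
  have h := ((dg.clm_apply dY).clm_apply dZ).fderiv
  have hn : ∀ y, g p y (p : Amb n) = 0 := fun y => by
    rw [hg.1.symm, hg.1.horizontal]
  have c1 := (connDiff_spec hg p w (Y p)).2 (Z p) (tZ p)
  have c2 := (connDiff_spec hg p w (Z p)).2 (Y p) (tY p)
  have s1 := dirDeriv_symm hg.1 p w (Z p) (Y p)
  rw [hg.1.symm] at c2
  have hL : dirDeriv (fun q => g q (Y q) (Z q)) p w =
      dirDeriv g p w (Y p) (Z p) + g p (dirDeriv Y p w) (Z p) + g p (Y p) (dirDeriv Z p w) := by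
    unfold dirDeriv
    rw [he, h]
    simp [radialExt_coe]
    ring
  rw [hL]
  unfold leviCivita roundConn tangentProj
  simp only [map_add, map_sub, map_smul, add_apply,
    sub_apply, smul_apply, hg.1.horizontal, hn, c1, c2, s1,
    smul_eq_mul, mul_zero, sub_zero]
  ring

end Equators

end

open Equators

/-! Fix a point `p` and let `C` be the covariant derivative of `g` there with respect to the round
connection. For an equator through `p` with `g`-unit normal `ν`, twice the mean curvature is the sum
of `C(ν,e,e) - 2C(e,e,ν)` over a `g`-orthonormal frame `e` of the equator (`secondFundForm_eq`).
Through `p` there is an equator with every tangent hyperplane, so minimality of all of them is a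
condition on `C` for all `ν`. Completing `e` by `ν` turns it into `C(ν,ν,ν) = 2 div(ν) - τ(ν)`,
where `τ` and `div` are the two traces of `C`. Polarizing this cubic identity and tracing it
eliminates `div` and leaves `(n+1) C(x,x,x) = 2 τ(x) g(x,x)` (`cubic_iff_of_frames`).

By Jacobi's formula `τ` is the logarithmic derivative of the Gram determinant of `g`
(`dirDeriv_gramDet`), which is the square of the volume density. So the identity says exactly that
the derivative of `g / F_g` vanishes on the diagonal, which is the Killing equation
(`minimal_iff_killing`). That the two maps are mutually inverse is then a computation with
exponents.

For the actions, the homogeneous extension of a Killing tensor is a quadratic form both in the base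
point and in the direction. Its polarization writes the tensor as a combination of products `V ⊙ W`
(`killing_eq_sum`), so a linear map is determined by its values on these. Up to the factor `|det
T|^(-4/(n+1)) |Tp|^4`, the action on tensors is pull-back by `φ(T)`. The same factor comes out of
the change of volume under `φ(T)`, which gives equivariance (`toKilling_pullback_phi`). The
correspondence then carries the action over to the metrics. -/

noncomputable section

namespace Equators

/-! ### Linear algebra at one point: vanishing mean curvatures and the cubic identity. -/

section InnerProductAlgebra

variable {E : Type*} [NormedAddCommGroup E] [InnerProductSpace ℝ E]

/-- Both sums are the trace of the endomorphism `A` that represents `Q`. -/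
theorem sum_bilin_orthonormalBasis_eq {ι ι' : Type*} [Fintype ι] [Fintype ι']
    (b : OrthonormalBasis ι ℝ E) (b' : OrthonormalBasis ι' ℝ E) (Q : E →ₗ[ℝ] E →ₗ[ℝ] ℝ) :
    ∑ i, Q (b i) (b i) = ∑ i, Q (b' i) (b' i) := by
  have : FiniteDimensional ℝ E := b.toBasis.finiteDimensional_of_finite
  let A : E →ₗ[ℝ] E := ∑ j, (Q.flip (b j)).smulRight (b j)
  have hA : ∀ x y, inner ℝ y (A x) = Q x y := fun x y => by
    conv_rhs => rw [← b.sum_repr y]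
    simp only [A, LinearMap.sum_apply, LinearMap.smulRight_apply, inner_sum, map_sum, map_smul,
      inner_smul_right, smul_eq_mul, b.repr_apply_apply, LinearMap.flip_apply]
    exact Finset.sum_congr rfl fun i _ => by rw [real_inner_comm, mul_comm]
  have h1 := A.trace_eq_sum_inner b
  have h2 := A.trace_eq_sum_inner b'
  simp only [hA] at h1 h2
  rw [← h1, ← h2]

/-- Polarization of the identity `C(x, x, x) = |x|² l(x)`. -/
theorem polarize_cubic {C : E →ₗ[ℝ] E →ₗ[ℝ] E →ₗ[ℝ] ℝ} (hC : ∀ x y z, C x y z = C x z y)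
    {l : E →ₗ[ℝ] ℝ} (h : ∀ x, C x x x = inner ℝ x x * l x) (x y : E) :
    C x y y + 2 * C y y x = inner ℝ y y * l x + 2 * (inner ℝ y x * l y) := by
  have h1 := h (x + y)
  have h2 := h (x - y)
  have h3 := h x
  simp only [map_add, map_sub, LinearMap.add_apply, LinearMap.sub_apply, inner_add_left,
    inner_sub_left, inner_add_right, inner_sub_right] at h1 h2
  rw [hC x y x, hC y x y, real_inner_comm y x] at h1 h2
  -- Averaging over `x + y` and `x - y` cancels the terms odd in `y`; subtracting the value at `x`
  -- leaves the part quadratic in `y`.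
  linear_combination (h1 + h2) / 2 - h3

/-- Sum the polarized identity over `y = b i`: the norms contribute `card ι` copies of `l x`, the
mixed terms two more. -/
theorem trace_of_cubic {ι : Type*} [Fintype ι] (b : OrthonormalBasis ι ℝ E)
    {C : E →ₗ[ℝ] E →ₗ[ℝ] E →ₗ[ℝ] ℝ} (hC : ∀ x y z, C x y z = C x z y)
    {l : E →ₗ[ℝ] ℝ} (h : ∀ x, C x x x = inner ℝ x x * l x) (x : E) :
    ∑ i, C x (b i) (b i) + 2 * ∑ i, C (b i) (b i) x = (Fintype.card ι + 2) * l x := by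
  have hx : l x = ∑ i, inner ℝ (b i) x * l (b i) := by
    conv_lhs => rw [← b.sum_repr x]
    simp [b.repr_apply_apply]
  rw [Finset.mul_sum, ← Finset.sum_add_distrib]
  simp only [polarize_cubic hC h, Finset.sum_add_distrib, ← Finset.mul_sum, ← hx]
  simp [b.orthonormal.1]
  ring

/-- The pointwise algebra behind the correspondence: `C` plays the role of the covariant derivative
of a metric, and the left-hand side says that all hyperplanes have vanishing mean curvature. -/
theorem cubic_iff_of_frames {n : ℕ} (hn : 1 ≤ n) (hE : Module.finrank ℝ E = n)
    {C : E →ₗ[ℝ] E →ₗ[ℝ] E →ₗ[ℝ] ℝ} (hC : ∀ x y z, C x y z = C x z y)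
    {τ : E →ₗ[ℝ] ℝ}
    (hτ : ∀ b : Fin n → E, (∀ i j, inner ℝ (b i) (b j) = if i = j then (1 : ℝ) else 0) →
      ∀ x, τ x = ∑ i, C x (b i) (b i)) :
    (∀ (ν : E) (e : Fin (n - 1) → E), inner ℝ ν ν = (1 : ℝ) →
      (∀ i j, inner ℝ (e i) (e j) = if i = j then (1 : ℝ) else 0) →
      (∀ i, inner ℝ ν (e i) = (0 : ℝ)) →
      ∑ i, (C ν (e i) (e i) - 2 * C (e i) (e i) ν) = 0) ↔
    ∀ x, (n + 1) * C x x x = 2 * τ x * inner ℝ x x := by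
  have : FiniteDimensional ℝ E := FiniteDimensional.of_finrank_pos (by omega)
  let b₀ : OrthonormalBasis (Fin n) ℝ E := (stdOrthonormalBasis ℝ E).reindex (finCongr hE)
  let Q : E → E →ₗ[ℝ] E →ₗ[ℝ] ℝ := fun x =>
    C x - (2 : ℝ) • (LinearMap.mk₂ ℝ (fun y z => C y z x) (by simp) (by simp) (by simp) (by simp))
  have hQ : ∀ x y z, Q x y z = C x y z - 2 * C y z x := fun x y z => by simp [Q]
  have hτ₀ := hτ b₀ (fun i j => orthonormal_iff_ite.mp b₀.orthonormal i j)
  have hfr : ∀ (ν : E) (e : Fin (n - 1) → E), inner ℝ ν ν = (1 : ℝ) →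
      (∀ i j, inner ℝ (e i) (e j) = if i = j then (1 : ℝ) else 0) →
      (∀ i, inner ℝ ν (e i) = (0 : ℝ)) →
      ∑ i, (C ν (e i) (e i) - 2 * C (e i) (e i) ν) =
        τ ν - 2 * ∑ i, C (b₀ i) (b₀ i) ν + C ν ν ν := by
    intro ν e hν he hνe
    -- The frame of the hyperplane is completed to an orthonormal basis with `ν` at index `none`.
    -- That index contributes `C ν ν ν - 2 * C ν ν ν` to the full trace, whence the term `+ C ν ν ν`
    -- above.
    let c : Option (Fin (n - 1)) → E := fun o => o.elim ν e
    have hc : Orthonormal ℝ c := by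
      rw [orthonormal_iff_ite]
      rintro (_ | i) (_ | j)
      · simpa [c] using hν
      · simpa [c] using hνe j
      · simpa [c, real_inner_comm] using hνe i
      · simpa [c] using he i j
    obtain ⟨b', hb'⟩ := Orthonormal.exists_orthonormalBasis_extension_of_card_eq
      (ι := Option (Fin (n - 1))) (𝕜 := ℝ) (E := E) (by simp; omega) (v := c) (s := Set.univ)
      (hc.comp _ Subtype.val_injective)
    have h := sum_bilin_orthonormalBasis_eq b' b₀ (Q ν)
    simp only [hb' _ (Set.mem_univ _), Fintype.sum_option, hQ, c, Option.elim] at h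
    rw [hτ₀, eq_sub_of_add_eq' h, Finset.mul_sum, ← Finset.sum_sub_distrib]
    ring
  constructor
  · intro h
    have hunit : ∀ ν : E, inner ℝ ν ν = (1 : ℝ) →
        C ν ν ν = 2 * ∑ i, C (b₀ i) (b₀ i) ν - τ ν := by
      intro ν hν
      let c : Option (Fin (n - 1)) → E := fun _ => ν
      have hc : Orthonormal ℝ (({none} : Set (Option (Fin (n - 1)))).domRestrict c) := by
        rw [orthonormal_iff_ite]
        rintro ⟨i, hi⟩ ⟨j, hj⟩
        simp only [Set.mem_singleton_iff] at hi hj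
        subst hi hj
        simpa [c] using hν
      obtain ⟨b', hb'⟩ := Orthonormal.exists_orthonormalBasis_extension_of_card_eq
        (ι := Option (Fin (n - 1))) (𝕜 := ℝ) (E := E) (by simp; omega) hc
      have hb0 : b' none = ν := hb' none rfl
      have ho := orthonormal_iff_ite.mp b'.orthonormal
      have he : ∀ i j, inner ℝ (b' (some i)) (b' (some j)) = if i = j then (1 : ℝ) else 0 := by
        intro i j
        simpa using ho (some i) (some j)
      have hνe : ∀ i, inner ℝ ν (b' (some i)) = (0 : ℝ) := fun i => by
        simpa [hb0] using ho none (some i)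
      have h1 := hfr ν (fun i => b' (some i)) hν he hνe
      rw [h ν _ hν he hνe] at h1
      linarith
    let l : E →ₗ[ℝ] ℝ := (2 : ℝ) • (∑ i, C (b₀ i) (b₀ i)) - τ
    have hl : ∀ x, l x = 2 * ∑ i, C (b₀ i) (b₀ i) x - τ x := fun x => by simp [l]
    have hcub : ∀ x, C x x x = inner ℝ x x * l x := by
      intro x
      by_cases hx : x = 0
      · simp [hx]
      have hnx : ‖x‖ ≠ 0 := norm_ne_zero_iff.mpr hx
      have h1 := hunit (‖x‖⁻¹ • x) (by
        rw [real_inner_smul_left, real_inner_smul_right, real_inner_self_eq_norm_sq]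
        field_simp)
      rw [← hl] at h1
      simp only [map_smul, LinearMap.smul_apply, smul_eq_mul] at h1
      rw [real_inner_self_eq_norm_sq]
      field_simp at h1
      linarith
    intro x
    have h2 := trace_of_cubic b₀ hC hcub x
    have h3 := hl x
    rw [← hτ₀, Fintype.card_fin] at h2
    -- The trace identity reads `τ + 2 div = (n+2) l`, and `2 div = l + τ` by the choice of `l`.
    have h4 : (n + 1 : ℝ) * l x = 2 * τ x := by linarith
    rw [hcub, ← h4]
    ring
  · intro h ν e hν he hνe
    rw [hfr ν e hν he hνe]
    have hn0 : (n : ℝ) + 1 ≠ 0 := by positivity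
    let l : E →ₗ[ℝ] ℝ := (2 / ((n : ℝ) + 1)) • τ
    have hcub : ∀ x, C x x x = inner ℝ x x * l x := by
      intro x
      simp only [l, LinearMap.smul_apply, smul_eq_mul]
      field_simp
      linarith [h x]
    have h2 := trace_of_cubic b₀ hC hcub ν
    have h3 : (n + 1 : ℝ) * l ν = 2 * τ ν := by
      simp only [l, LinearMap.smul_apply, smul_eq_mul]
      field_simp
    rw [← hτ₀, Fintype.card_fin] at h2
    rw [hcub, hν]
    linarith

end InnerProductAlgebra

/-- The inner product core of a positive definite symmetric bilinear form. -/
@[reducible]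
def bilinCore {V : Type*} [AddCommGroup V] [Module ℝ V] (B : V →ₗ[ℝ] V →ₗ[ℝ] ℝ)
    (hs : ∀ x y, B x y = B y x) (hB : ∀ x, x ≠ 0 → 0 < B x x) : InnerProductSpace.Core ℝ V where
  inner x y := B x y
  conj_inner_symm x y := hs y x
  re_inner_nonneg x := by
    by_cases hx : x = 0
    · simp [hx]
    · exact (hB x hx).le
  add_left x y z := by simp
  smul_left x y r := by simp
  definite x hx := by
    by_contra h
    exact (hB x h).ne' hx

theorem exists_orthonormal_family {V : Type*} [AddCommGroup V] [Module ℝ V]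
    [FiniteDimensional ℝ V] {n : ℕ} (hV : Module.finrank ℝ V = n) (B : V →ₗ[ℝ] V →ₗ[ℝ] ℝ)
    (hs : ∀ x y, B x y = B y x) (hB : ∀ x, x ≠ 0 → 0 < B x x) :
    ∃ b : Fin n → V, ∀ i j, B (b i) (b j) = if i = j then 1 else 0 := by
  let core := bilinCore B hs hB
  -- `V` is only a module in the hypotheses, so its norm and inner product can be taken from `B`.
  let _ : NormedAddCommGroup V := core.toNormedAddCommGroup
  let _ : InnerProductSpace ℝ V := InnerProductSpace.ofCore core.toCore
  let b := (stdOrthonormalBasis ℝ V).reindex (finCongr hV)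
  exact ⟨b, fun i j => orthonormal_iff_ite.mp b.orthonormal i j⟩

/-- `cubic_iff_of_frames` for the inner product given by a bilinear form. -/
theorem cubic_iff_of_bilin_frames {V : Type*} [AddCommGroup V] [Module ℝ V]
    {n : ℕ} (hn : 1 ≤ n) (hV : Module.finrank ℝ V = n)
    (B : V →ₗ[ℝ] V →ₗ[ℝ] ℝ) (hs : ∀ x y, B x y = B y x) (hB : ∀ x, x ≠ 0 → 0 < B x x)
    {C : V →ₗ[ℝ] V →ₗ[ℝ] V →ₗ[ℝ] ℝ} (hC : ∀ x y z, C x y z = C x z y)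
    {τ : V →ₗ[ℝ] ℝ}
    (hτ : ∀ b : Fin n → V, (∀ i j, B (b i) (b j) = if i = j then 1 else 0) →
      ∀ x, τ x = ∑ i, C x (b i) (b i)) :
    (∀ (ν : V) (e : Fin (n - 1) → V), B ν ν = 1 →
      (∀ i j, B (e i) (e j) = if i = j then 1 else 0) → (∀ i, B ν (e i) = 0) →
      ∑ i, (C ν (e i) (e i) - 2 * C (e i) (e i) ν) = 0) ↔
    ∀ x, (n + 1) * C x x x = 2 * τ x * B x x := by
  let core := bilinCore B hs hB
  let _ : NormedAddCommGroup V := core.toNormedAddCommGroup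
  let _ : InnerProductSpace ℝ V := InnerProductSpace.ofCore core.toCore
  exact cubic_iff_of_frames (E := V) hn hV hC hτ

/-! ### Radial extensions and bilinear forms along the sphere. -/

section Basics

variable {n : ℕ}

theorem norm_coe_sphere (p : Sphere n) : ‖(p : Amb n)‖ = 1 := mem_sphere_zero_iff_norm.mp p.2

theorem coe_sphere_ne_zero (p : Sphere n) : (p : Amb n) ≠ 0 := by
  intro h
  have := norm_coe_sphere p
  simp [h] at this

theorem inner_coe_self (p : Sphere n) : inner ℝ (p : Amb n) (p : Amb n) = (1 : ℝ) := by
  rw [real_inner_self_eq_norm_sq, norm_coe_sphere]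
  norm_num

theorem IsSymTensor.horizontal_right {h : BilinField n} (hh : IsSymTensor h) (p : Sphere n)
    (y : Amb n) : h p y (p : Amb n) = 0 := by
  rw [hh.symm, hh.horizontal]

theorem radialExt_pos_smul {F : Type*} [Zero F] (f : Sphere n → F) {r : ℝ} (hr : 0 < r)
    (x : Amb n) : radialExt f (r • x) = radialExt f x := by
  by_cases hx : x = 0
  · simp [hx]
  have hrx : r • x ≠ 0 := smul_ne_zero hr.ne' hx
  rw [radialExt, radialExt, dif_neg hx, dif_neg hrx]
  congr 1
  apply Subtype.ext
  simp only [radialProj, norm_smul, Real.norm_of_nonneg hr.le, smul_smul, mul_inv]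
  congr 1
  field_simp

theorem exists_pos_smul_sphere {x : Amb n} (hx : x ≠ 0) :
    ∃ (p : Sphere n) (r : ℝ), 0 < r ∧ x = r • (p : Amb n) := by
  refine ⟨radialProj x hx, ‖x‖, norm_pos_iff.mpr hx, ?_⟩
  simp only [radialProj]
  rw [smul_inv_smul₀ (norm_ne_zero_iff.mpr hx)]

theorem inner_tangentProj (p : Sphere n) (y : Amb n) :
    inner ℝ (p : Amb n) (tangentProj p y) = 0 := by
  simp [tangentProj, inner_sub_right, inner_smul_right]

theorem bilin_tangentProj {h : BilinField n} (hh : IsSymTensor h) (p : Sphere n) (x y : Amb n) :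
    h p (tangentProj p x) (tangentProj p y) = h p x y := by
  simp [tangentProj, hh.horizontal, hh.horizontal_right]

theorem bilin_expand (L : Amb n →L[ℝ] Amb n →L[ℝ] ℝ) (c d : Amb n) :
    L c d = ∑ i, ∑ j, c i * d j * L (EuclideanSpace.single i 1) (EuclideanSpace.single j 1) := by
  have h : ∀ x : Amb n, x = ∑ i, x i • EuclideanSpace.single i (1 : ℝ) := fun x => by
    conv_lhs => rw [← (EuclideanSpace.basisFun (Fin (n + 1)) ℝ).sum_repr x]
    simp
  conv_lhs => rw [h c, h d]
  simp only [map_sum, map_smul, sum_apply, smul_apply,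
    smul_eq_mul, Finset.mul_sum]
  rw [Finset.sum_comm]
  exact Finset.sum_congr rfl fun i _ => Finset.sum_congr rfl fun j _ => by ring

theorem bilin_ext {L M : Amb n →L[ℝ] Amb n →L[ℝ] ℝ} (hL : ∀ x y, L x y = L y x)
    (hM : ∀ x y, M x y = M y x) (h : ∀ x, L x x = M x x) : L = M := by
  ext x y
  have h1 := h (x + y)
  simp only [map_add, add_apply] at h1
  linarith [h x, h y, hL x y, hM x y]

end Basics

/-! ### Killing tensors are spanned by symmetric products of Killing fields. -/

section Span

variable {n : ℕ}

/-- The homogeneous extension of a two-tensor on the sphere: its value at `x` is `|x|⁴ π^* k`,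
where `π` is the radial projection. -/
def homExt (k : BilinField n) (x : Amb n) : Amb n →L[ℝ] Amb n →L[ℝ] ℝ :=
  ‖x‖ ^ 2 • radialExt k x

theorem homExt_coe (k : BilinField n) (p : Sphere n) : homExt k p = k p := by
  simp [homExt, radialExt_coe]

theorem homExt_pos_smul (k : BilinField n) (p : Sphere n) {r : ℝ} (hr : 0 < r) :
    homExt k (r • (p : Amb n)) = r ^ 2 • k p := by
  rw [homExt, radialExt_pos_smul _ hr, radialExt_coe, norm_smul, norm_coe_sphere,
    Real.norm_of_nonneg hr.le, mul_one]

theorem homExt_symm {k : BilinField n} (hk : IsSymTensor k) (x y z : Amb n) :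
    homExt k x y z = homExt k x z y := by
  by_cases hx : x = 0
  · simp [homExt, hx]
  obtain ⟨p, r, hr, rfl⟩ := exists_pos_smul_sphere hx
  simp [homExt_pos_smul k p hr, hk.symm p y z]

theorem homExt_self {k : BilinField n} (hk : IsSymTensor k) (x y : Amb n) :
    homExt k x x y = 0 := by
  by_cases hx : x = 0
  · simp [homExt, hx]
  obtain ⟨p, r, hr, rfl⟩ := exists_pos_smul_sphere hx
  simp [homExt_pos_smul k p hr, hk.horizontal]

/-- A Killing tensor is symmetric under the exchange of the base point and the direction. -/
theorem homExt_swap {k : BilinField n} (hk : k ∈ killingTensors n) (x y : Amb n) :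
    homExt k x y y = homExt k y x x := by
  by_cases hx : x = 0
  · simp [homExt, hx]
  by_cases hy : y = 0
  · simp [homExt, hy]
  obtain ⟨p, r, hr, rfl⟩ := exists_pos_smul_sphere hx
  have hd : y = (inner ℝ (p : Amb n) y) • (p : Amb n) + tangentProj p y := by
    simp [tangentProj]
  by_cases hu : tangentProj p y = 0
  -- If `y` is collinear with `p`, both sides vanish because `k` annihilates the normal direction.
  · rw [hu, add_zero] at hd
    set a := inner ℝ (p : Amb n) y
    have ha : a ≠ 0 := by
      rintro h
      rw [h, zero_smul] at hd
      exact hy hd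
    have h1 : homExt k y (r • (p : Amb n)) (r • (p : Amb n)) = 0 := by
      have h2 : (p : Amb n) = a⁻¹ • y := by
        rw [hd, smul_smul, inv_mul_cancel₀ ha, one_smul]
      simp [h2, homExt_self hk.1]
    rw [h1, homExt_pos_smul k p hr, hd]
    simp [hk.1.horizontal]
  · set u := tangentProj p y
    set a := inner ℝ (p : Amb n) y
    have hb : 0 < ‖u‖ := norm_pos_iff.mpr hu
    set b := ‖u‖
    have hw : ‖b⁻¹ • u‖ = 1 := by
      rw [norm_smul, norm_inv, Real.norm_of_nonneg hb.le]
      exact inv_mul_cancel₀ hb.ne'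
    have hpw : inner ℝ (p : Amb n) (b⁻¹ • u) = 0 := by
      rw [inner_smul_right, inner_tangentProj, mul_zero]
    set w := b⁻¹ • u
    have huw : u = b • w := by
      rw [smul_smul, mul_inv_cancel₀ hb.ne', one_smul]
    -- Polar coordinates in the plane of `p` and `w`: the geodesic from `p` in the direction `w`
    -- meets the ray of `y` at time `arg c`. Since `k` is constant along it, both sides can be
    -- expressed by `k p w w`.
    let c : ℂ := ⟨a, b⟩
    have hc : 0 < ‖c‖ := norm_pos_iff.mpr fun h => hb.ne' (congrArg Complex.im h)
    have hcos : ‖c‖ * Real.cos c.arg = a := Complex.norm_mul_cos_arg c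
    have hsin : ‖c‖ * Real.sin c.arg = b := Complex.norm_mul_sin_arg c
    set s := ‖c‖
    set t := c.arg
    have hyg : y = s • (geodesic p w hw hpw t : Amb n) := by
      conv_lhs => rw [hd, huw]
      simp only [geodesic, smul_add]
      rw [smul_smul s, smul_smul s, hcos, hsin]
    -- Seen from the point of the geodesic at time `t`, the tangential part of `p` is `-sin t` times
    -- the velocity.
    have hpg : (p : Amb n) = Real.cos t • (geodesic p w hw hpw t : Amb n) +
        (-Real.sin t) • velocity p w t := by
      simp only [geodesic, velocity]
      have h4 := Real.sin_sq_add_cos_sq t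
      have h5 : (p : Amb n) = (Real.sin t ^ 2 + Real.cos t ^ 2) • (p : Amb n) := by
        rw [h4, one_smul]
      conv_lhs => rw [h5]
      module
    have hkg := hk.2 p w hw hpw t 0
    have hg0 : geodesic p w hw hpw 0 = p := Subtype.ext (by simp [geodesic])
    have hv0 : velocity p w 0 = w := by simp [velocity]
    rw [hg0, hv0] at hkg
    have e1 : homExt k (r • (p : Amb n)) y y = r ^ 2 * b ^ 2 * k p w w := by
      rw [homExt_pos_smul k p hr, hd, huw]
      simp [hk.1.horizontal, hk.1.horizontal_right]
      ring
    have e2 : homExt k y (r • (p : Amb n)) (r • (p : Amb n)) =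
        s ^ 2 * (r ^ 2 * (Real.sin t ^ 2 * k p w w)) := by
      rw [hyg, homExt_pos_smul k _ hc, hpg]
      simp only [map_add, map_smul, add_apply, smul_apply, smul_eq_mul, hk.1.horizontal,
        hk.1.horizontal_right, hkg]
      ring
    rw [e1, e2, ← hsin]
    ring

/-- The polarization of the homogeneous extension in the base point. -/
def homPolar (k : BilinField n) (x y : Amb n) : Amb n →L[ℝ] Amb n →L[ℝ] ℝ :=
  (1 / 2 : ℝ) • (homExt k (x + y) - homExt k x - homExt k y)

/-- By `homExt_swap` the dependence on the base point is that of a quadratic form, although no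
polynomial dependence was assumed; `homPolar` is its polarization. -/
theorem homPolar_self {k : BilinField n} (hk : k ∈ killingTensors n) (x y z : Amb n) :
    homPolar k x y z z = homExt k z x y := by
  have h := homExt_symm hk.1 z x y
  simp [homPolar, homExt_swap hk _ z]
  linarith

theorem homPolar_symm {k : BilinField n} (hk : k ∈ killingTensors n) (x y z w : Amb n) :
    homPolar k x y z w = homPolar k x y w z := by
  simp only [homPolar, smul_apply, sub_apply,
    homExt_symm hk.1 _ z w]

theorem homPolar_comm (k : BilinField n) (x y : Amb n) : homPolar k x y = homPolar k y x := by
  ext z w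
  simp only [homPolar, smul_apply, sub_apply, add_comm x y]
  ring

/-- Polarize `homPolar_self` in `z`. Linearity in the last two arguments thereby passes to the first
two, so `homPolar k` is quadrilinear. -/
theorem homPolar_swap {k : BilinField n} (hk : k ∈ killingTensors n) (x y z w : Amb n) :
    homPolar k x y z w = homPolar k z w x y := by
  have h := homPolar_self hk x y (z + w)
  have h1 := homPolar_self hk x y z
  have h2 := homPolar_self hk x y w
  have h3 := homPolar_symm hk x y z w
  have h4 : homPolar k z w x y = (homExt k (z + w) x y - homExt k z x y - homExt k w x y) / 2 := by
    simp [homPolar]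
    ring
  simp only [map_add, add_apply] at h
  linarith

/-- This is a Bianchi-type identity: expand the vanishing of the tensor at `x + y` on its radial
direction `x + y`, paired with `y`. -/
theorem homPolar_cross {k : BilinField n} (hk : k ∈ killingTensors n) (x y : Amb n) :
    2 * homPolar k x y x y = -homExt k x y y := by
  have h1 := homExt_self hk.1 (x + y) y
  have h2 := homExt_swap hk (x + y) y
  have h3 := homExt_self hk.1 x y
  have h4 := homExt_self hk.1 y x
  have h5 := homExt_self hk.1 y y
  have h6 := homExt_symm hk.1 y x y
  have h7 := homExt_swap hk x y
  simp only [homPolar, smul_apply, sub_apply, map_add,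
    add_apply, smul_eq_mul] at h1 h2 ⊢
  linarith

theorem homPolar_expand {k : BilinField n} (hk : k ∈ killingTensors n) (x y z w : Amb n) :
    homPolar k x y z w = ∑ i, ∑ j, ∑ a, ∑ b, x i * y j * z a * w b *
      homPolar k (EuclideanSpace.single i 1) (EuclideanSpace.single j 1)
        (EuclideanSpace.single a 1) (EuclideanSpace.single b 1) := by
  rw [homPolar_swap hk, bilin_expand]
  refine Finset.sum_congr rfl fun i _ => Finset.sum_congr rfl fun j _ => ?_
  rw [homPolar_swap hk, bilin_expand, Finset.mul_sum]
  refine Finset.sum_congr rfl fun a _ => ?_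
  rw [Finset.mul_sum]
  exact Finset.sum_congr rfl fun b _ => by ring

/-- The elementary skew-symmetric matrices. -/
def elemSkew (i j : Fin (n + 1)) : son n :=
  ⟨Matrix.single i j 1 - Matrix.single j i 1, by simp⟩

theorem inner_act_elemSkew (i j : Fin (n + 1)) (x y : Amb n) :
    inner ℝ (act (elemSkew i j).1 x) y = x j * y i - x i * y j := by
  rw [real_inner_comm, act, Matrix.inner_toEuclideanCLM]
  simp only [elemSkew, Matrix.sub_mulVec, dotProduct_sub, Matrix.single_mulVec]
  change y.ofLp ⬝ᵥ Pi.single i (1 * x j) - y.ofLp ⬝ᵥ Pi.single j (1 * x i) = _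
  rw [dotProduct_single, dotProduct_single]
  ring

/-- Contracting the polarization `P` with the coordinates of `p ∧ y` twice gives `P(p,p,y,y) -
P(p,y,y,p) - P(y,p,p,y) + P(y,y,p,p)`. The outer terms are `k p y y` and the inner ones `-(k p y y)
/ 2`, so the sum is `3 * k p y y`. The product `⊙` doubles on the diagonal, hence the `6`. -/
theorem killing_eq_sum {k : BilinField n} (hk : k ∈ killingTensors n) :
    k = ∑ i, ∑ j, ∑ a, ∑ b,
      (homPolar k (EuclideanSpace.single i 1) (EuclideanSpace.single j 1)
        (EuclideanSpace.single a 1) (EuclideanSpace.single b 1) / 6) •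
          symProd (elemSkew i a) (elemSkew j b) := by
  funext p
  apply bilin_ext (hk.1.symm p)
  · intro x y
    simp only [Finset.sum_apply, Pi.smul_apply, sum_apply,
      smul_apply, symProd_apply]
    refine Finset.sum_congr rfl fun i _ => Finset.sum_congr rfl fun j _ =>
      Finset.sum_congr rfl fun a _ => Finset.sum_congr rfl fun b _ => ?_
    congr 1
    ring
  · intro y
    have e1 := homPolar_expand hk p p y y
    have e2 := homPolar_expand hk p y y p
    have e3 := homPolar_expand hk y p p y
    have e4 := homPolar_expand hk y y p p
    have f1 : homPolar k p p y y = k p y y := by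
      rw [homPolar_self hk, homExt_swap hk, homExt_coe]
    have f4 : homPolar k y y p p = k p y y := by
      rw [homPolar_self hk, homExt_coe]
    have f3 : homPolar k y p p y = -(k p y y) / 2 := by
      have := homPolar_cross hk p y
      rw [homExt_coe] at this
      rw [homPolar_comm]
      linarith
    have f2 : homPolar k p y y p = -(k p y y) / 2 := by
      rw [homPolar_symm hk, homPolar_comm, f3]
    have key : k p y y = (homPolar k p p y y - homPolar k p y y p - homPolar k y p p y +
        homPolar k y y p p) / 3 := by
      rw [f1, f2, f3, f4]
      ring
    rw [key, e1, e2, e3, e4]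
    simp only [Finset.sum_apply, Pi.smul_apply, sum_apply,
      smul_apply, symProd_apply, inner_act_elemSkew, smul_eq_mul,
      ← Finset.sum_sub_distrib, ← Finset.sum_add_distrib, Finset.sum_div]
    refine Finset.sum_congr rfl fun i _ => Finset.sum_congr rfl fun j _ =>
      Finset.sum_congr rfl fun a _ => Finset.sum_congr rfl fun b _ => ?_
    ring

/-- This is what makes the linear action on Killing tensors unique. -/
theorem span_killingProd :
    Submodule.span ℝ (Set.range fun q : son n × son n => killingProd q.1 q.2) = ⊤ := by
  rw [eq_top_iff]
  rintro k -
  have h : k = ∑ i, ∑ j, ∑ a, ∑ b,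
      (homPolar (k : BilinField n) (EuclideanSpace.single i 1) (EuclideanSpace.single j 1)
        (EuclideanSpace.single a 1) (EuclideanSpace.single b 1) / 6) •
          killingProd (elemSkew i a) (elemSkew j b) := by
    apply Subtype.ext
    conv_lhs => rw [killing_eq_sum k.2]
    simp [killingProd]
  rw [h]
  exact Submodule.sum_mem _ fun i _ => Submodule.sum_mem _ fun j _ => Submodule.sum_mem _
    fun a _ => Submodule.sum_mem _ fun b _ => Submodule.smul_mem _ _
      (Submodule.subset_span ⟨(_, _), rfl⟩)

end Span

/-! ### The action of the general linear group on tensors, and pull-back by `φ(T)`. -/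

section Action

variable {n : ℕ}

theorem act_mul_apply (M N : Matrix (Fin (n + 1)) (Fin (n + 1)) ℝ) (x : Amb n) :
    act (M * N) x = act M (act N x) := by
  rw [act, map_mul]
  rfl

theorem inner_act_transpose (M : Matrix (Fin (n + 1)) (Fin (n + 1)) ℝ) (x y : Amb n) :
    inner ℝ (act Mᵀ x) y = inner ℝ x (act M y) := by
  rw [← Matrix.conjTranspose_eq_transpose_of_trivial, ← Matrix.star_eq_conjTranspose, act,
    map_star, ContinuousLinearMap.star_eq_adjoint, ContinuousLinearMap.adjoint_inner_left]

theorem abs_det_pos (T : GLn n) :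
    0 < |(T : Matrix (Fin (n + 1)) (Fin (n + 1)) ℝ).det| :=
  abs_pos.mpr ((Matrix.isUnit_iff_isUnit_det _).mp T.isUnit).ne_zero

theorem phi_coe (T : GLn n) (p : Sphere n) :
    (phi T p : Amb n) = ‖act T.1 (p : Amb n)‖⁻¹ • act T.1 (p : Amb n) := rfl

theorem act_eq_smul_phi (T : GLn n) (p : Sphere n) :
    act T.1 (p : Amb n) = ‖act T.1 (p : Amb n)‖ • (phi T p : Amb n) := by
  rw [phi_coe, smul_inv_smul₀ (norm_ne_zero_iff.mpr (act_ne_zero T p))]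

/-- The action of the general linear group on two-tensors which extends the action on symmetric
products of Killing fields. -/
def tensorAct (T : GLn n) : BilinField n →ₗ[ℝ] BilinField n where
  toFun k p := (|T.1.det| ^ (-(4 / ((n : ℝ) + 1))) * ‖act T.1 (p : Amb n)‖ ^ 2) •
    (k (phi T p)).bilinearComp (act T.1) (act T.1)
  map_add' k l := by
    ext p x y
    simp
    ring
  map_smul' c k := by
    ext p x y
    simp
    ring

theorem tensorAct_apply (T : GLn n) (k : BilinField n) (p : Sphere n) (x y : Amb n) :
    tensorAct T k p x y = (|T.1.det| ^ (-(4 / ((n : ℝ) + 1))) * ‖act T.1 (p : Amb n)‖ ^ 2) *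
      k (phi T p) (act T.1 x) (act T.1 y) := rfl

theorem inner_act_soAct (V : son n) (T : GLn n) (p : Sphere n) (x : Amb n) :
    inner ℝ (act (soAct V T).1 (p : Amb n)) x = |T.1.det| ^ (-(2 / ((n : ℝ) + 1))) *
      (‖act T.1 (p : Amb n)‖ * inner ℝ (act V.1 (phi T p : Amb n)) (act T.1 x)) := by
  have h : act (soAct V T).1 (p : Amb n) = |T.1.det| ^ (-(2 / ((n : ℝ) + 1))) •
      act T.1ᵀ (act V.1 (act T.1 (p : Amb n))) := by
    rw [← act_mul_apply, ← act_mul_apply]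
    simp only [soAct, act, map_smul, smul_apply]
  rw [h, real_inner_smul_left, inner_act_transpose, act_eq_smul_phi, map_smul,
    real_inner_smul_left, norm_smul, norm_norm, norm_coe_sphere, mul_one]

/-- Each of the two Killing fields contributes one factor `|det T|^(-2/(n+1))` and one factor
`|Tp|`; this dictates the scalar in `tensorAct`. -/
theorem tensorAct_symProd (T : GLn n) (V W : son n) :
    tensorAct T (symProd V W) = symProd (soAct V T) (soAct W T) := by
  ext p x y
  have h : |T.1.det| ^ (-(4 / ((n : ℝ) + 1))) =
      |T.1.det| ^ (-(2 / ((n : ℝ) + 1))) * |T.1.det| ^ (-(2 / ((n : ℝ) + 1))) := by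
    rw [← Real.rpow_add (abs_det_pos T)]
    congr 1
    ring
  rw [tensorAct_apply, symProd_apply, symProd_apply, h]
  simp only [inner_act_soAct]
  ring

/-- On products `V ⊙ W` the image is again such a product, so smoothness and the Killing condition
need no separate check. -/
theorem tensorAct_mem (T : GLn n) {k : BilinField n} (hk : k ∈ killingTensors n) :
    tensorAct T k ∈ killingTensors n := by
  rw [killing_eq_sum hk]
  simp only [map_sum, map_smul, tensorAct_symProd]
  exact Submodule.sum_mem _ fun i _ => Submodule.sum_mem _ fun j _ => Submodule.sum_mem _
    fun a _ => Submodule.sum_mem _ fun b _ => Submodule.smul_mem _ _ (symProd_mem _ _)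

/-- The action of the general linear group on Killing tensors. -/
def killingAct (T : GLn n) : killingTensors n →ₗ[ℝ] killingTensors n :=
  (tensorAct T).restrict fun _ => tensorAct_mem T

theorem killingAct_killingProd (T : GLn n) (V W : son n) :
    killingAct T (killingProd V W) = killingProd (soAct V T) (soAct W T) :=
  Subtype.ext (tensorAct_symProd T V W)

theorem killing_linearMap_ext {A B : killingTensors n →ₗ[ℝ] killingTensors n}
    (h : ∀ V W, A (killingProd V W) = B (killingProd V W)) : A = B := by
  refine LinearMap.ext_on_range span_killingProd ?_
  rintro ⟨V, W⟩
  exact h V W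

theorem soAct_one (V : son n) : soAct V 1 = V := by
  apply Subtype.ext
  simp [soAct]

theorem soAct_mul (V : son n) (S T : GLn n) : soAct (soAct V S) T = soAct V (S * T) := by
  apply Subtype.ext
  simp only [soAct, Units.val_mul, Matrix.det_mul, abs_mul, Matrix.transpose_mul,
    Matrix.mul_smul, Matrix.smul_mul, smul_smul, Matrix.mul_assoc]
  rw [Real.mul_rpow (abs_nonneg _) (abs_nonneg _), mul_comm]

theorem killingAct_one (k : killingTensors n) : killingAct 1 k = k := by
  have h : killingAct (1 : GLn n) = LinearMap.id := killing_linearMap_ext fun V W => by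
    rw [killingAct_killingProd, soAct_one, soAct_one]
    rfl
  rw [h]
  rfl

theorem killingAct_mul (S T : GLn n) (k : killingTensors n) :
    killingAct T (killingAct S k) = killingAct (S * T) k := by
  have h : (killingAct T).comp (killingAct S) = killingAct (S * T) :=
    killing_linearMap_ext fun V W => by
      rw [LinearMap.comp_apply, killingAct_killingProd, killingAct_killingProd,
        killingAct_killingProd, soAct_mul, soAct_mul]
  rw [← h]
  rfl

theorem act_injective (T : GLn n) : Function.Injective (act T.1) := by
  intro x y h
  have h2 := congrArg (act (T⁻¹).1) h
  rw [← act_mul_apply, ← act_mul_apply, ← Units.val_mul, inv_mul_cancel] at h2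
  simpa using h2

theorem isPosDef_tensorAct (T : GLn n) {k : BilinField n} (hk : IsSymTensor k)
    (hp : IsPosDef k) : IsPosDef (tensorAct T k) := by
  intro p w hpw hw
  rw [tensorAct_apply]
  have h1 : 0 < |T.1.det| ^ (-(4 / ((n : ℝ) + 1))) := Real.rpow_pos_of_pos (abs_det_pos T) _
  have h2 : 0 < ‖act T.1 (p : Amb n)‖ := norm_pos_iff.mpr (act_ne_zero T p)
  refine mul_pos (by positivity) ?_
  -- `T w` need not be tangent at `φ(T) p`, but only its tangential part counts. If that part
  -- vanished, `T w` would be a multiple of `T p`, hence `w` one of `p`, and `w ⊥ p` would force `w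
  -- = 0`.
  rw [← bilin_tangentProj hk]
  refine hp _ _ (inner_tangentProj _ _) fun h => hw ?_
  rw [tangentProj, sub_eq_zero, phi_coe, smul_smul, ← map_smul] at h
  have h3 := act_injective T h
  set c := inner ℝ (‖act T.1 (p : Amb n)‖⁻¹ • act T.1 (p : Amb n)) (act T.1 w) *
    ‖act T.1 (p : Amb n)‖⁻¹
  have h4 : c = 0 := by
    rw [h3, inner_smul_right, inner_coe_self, mul_one] at hpw
    exact hpw
  rw [h3, h4, zero_smul]

/-- The differential of `z ↦ Tz / |Tz|` is `w ↦ Tw / |Tp|` plus a multiple of the normal `φ(T) p`,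
which `h` annihilates. -/
theorem pullback_phi_apply {h : BilinField n} (hh : IsSymTensor h) (T : GLn n) (p : Sphere n)
    (x y : Amb n) : pullback (phi T) h p x y =
      (‖act T.1 (p : Amb n)‖ ^ 2)⁻¹ * h (phi T p) (act T.1 x) (act T.1 y) := by
  have hT := act_ne_zero T p
  have he : (radialExt fun q => (phi T q : Amb n)) =ᶠ[nhds (p : Amb n)]
      fun z => ‖act T.1 z‖⁻¹ • act T.1 z := by
    filter_upwards [isOpen_compl_singleton.mem_nhds (coe_sphere_ne_zero p)] with z hz
    have hz' : z ≠ 0 := hz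
    have hn := norm_ne_zero_iff.mpr hz'
    rw [radialExt, dif_neg hz', phi_coe, radialProj]
    simp only [map_smul, norm_smul, norm_inv, norm_norm, smul_smul]
    congr 1
    field_simp
  have hl : DifferentiableAt ℝ (fun z : Amb n => ‖act T.1 z‖⁻¹) (p : Amb n) :=
    (((contDiffAt_norm ℝ hT).comp (p : Amb n) (act T.1).contDiff.contDiffAt).differentiableAt
      one_ne_zero).inv (norm_ne_zero_iff.mpr hT)
  have hd : HasFDerivAt (fun z => ‖act T.1 z‖⁻¹ • act T.1 z) _ (p : Amb n) :=
    hl.hasFDerivAt.smul (act T.1).hasFDerivAt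
  have hs : ∀ w, sphereDeriv (phi T) p w = ‖act T.1 (p : Amb n)‖⁻¹ • act T.1 w +
      (fderiv ℝ (fun z : Amb n => ‖act T.1 z‖⁻¹) (p : Amb n) w * ‖act T.1 (p : Amb n)‖) •
        (phi T p : Amb n) := by
    intro w
    rw [sphereDeriv, he.fderiv_eq, hd.fderiv, ← smul_smul, ← act_eq_smul_phi]
    rfl
  rw [pullback, ContinuousLinearMap.bilinearComp_apply, hs, hs]
  simp only [map_add, map_smul, add_apply, smul_apply, hh.horizontal, hh.horizontal_right,
    smul_eq_mul]
  ring

theorem pullback_phi_horizontal {h : BilinField n} (hh : IsSymTensor h) (T : GLn n)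
    (p : Sphere n) (x : Amb n) : pullback (phi T) h p (p : Amb n) x = 0 := by
  rw [pullback_phi_apply hh, act_eq_smul_phi T p, map_smul, smul_apply, hh.horizontal, smul_zero,
    mul_zero]

end Action

/-! ### Volume densities: scaling, pull-back, and the inverse correspondence. -/

section Volume

variable {n : ℕ}

/-- Since `A` kills `p` on both sides, the two matrices are congruent through `1 + p ⊗ (u - p)`, of
determinant one. It is needed because `T` pulls the normal form `q ⊗ q` back to some `u ⊗ u` other
than `p ⊗ p`. -/
theorem det_add_vecMulVec_eq {m : Type*} [Fintype m] [DecidableEq m] (A : Matrix m m ℝ)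
    (p u : m → ℝ) (h1 : A *ᵥ p = 0) (h2 : p ᵥ* A = 0) (hp : p ⬝ᵥ p = 1) (hu : u ⬝ᵥ p = 1) :
    (A + Matrix.vecMulVec u u).det = (A + Matrix.vecMulVec p p).det := by
  have hS : (1 + Matrix.vecMulVec p (u - p)).det = 1 := by
    rw [Matrix.vecMulVec_eq Unit, Matrix.det_one_add_replicateCol_mul_replicateRow,
      sub_dotProduct, hu, hp]
    norm_num
  have hS' : (1 + Matrix.vecMulVec (u - p) p).det = 1 := by
    rw [← Matrix.det_transpose, Matrix.transpose_add, Matrix.transpose_one,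
      Matrix.transpose_vecMulVec, hS]
  have key : A + Matrix.vecMulVec u u = (1 + Matrix.vecMulVec (u - p) p) *
      (A + Matrix.vecMulVec p p) * (1 + Matrix.vecMulVec p (u - p)) := by
    have e1 : (1 + Matrix.vecMulVec (u - p) p) * (A + Matrix.vecMulVec p p) =
        A + Matrix.vecMulVec u p := by
      rw [add_mul, one_mul, mul_add, Matrix.vecMulVec_mul, h2, Matrix.vecMulVec_mul_vecMulVec, hp,
        Matrix.vecMulVec_zero, zero_add, one_smul, add_assoc, ← Matrix.add_vecMulVec]
      simp
    rw [e1, mul_add, mul_one, add_mul, Matrix.mul_vecMulVec, h1, Matrix.vecMulVec_mul_vecMulVec,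
      hp, Matrix.zero_vecMulVec, zero_add, one_smul, add_assoc, ← Matrix.vecMulVec_add]
    simp
  rw [key, Matrix.det_mul, Matrix.det_mul, hS, hS', one_mul, mul_one]

/-- The matrix of a bilinear form in the standard basis. -/
def formMatrix (L : Amb n →L[ℝ] Amb n →L[ℝ] ℝ) : Matrix (Fin (n + 1)) (Fin (n + 1)) ℝ :=
  Matrix.of fun i j => L (EuclideanSpace.single i 1) (EuclideanSpace.single j 1)

/-- The determinant of `h + p ⊗ p`, which is the Gram determinant of `h` on the tangent space. -/
def gramDet (h : BilinField n) (p : Sphere n) : ℝ :=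
  (formMatrix (h p) + Matrix.vecMulVec (p : Amb n).ofLp (p : Amb n).ofLp).det

theorem inner_eq_dotProduct (x y : Amb n) : inner ℝ x y = x.ofLp ⬝ᵥ y.ofLp := by
  simp [PiLp.inner_apply, dotProduct, mul_comm]

theorem apply_eq_dotProduct (L : Amb n →L[ℝ] Amb n →L[ℝ] ℝ) (x y : Amb n) :
    L x y = x.ofLp ⬝ᵥ formMatrix L *ᵥ y.ofLp := by
  rw [bilin_expand]
  simp only [dotProduct, Matrix.mulVec, formMatrix, Matrix.of_apply, Finset.mul_sum]
  exact Finset.sum_congr rfl fun i _ => Finset.sum_congr rfl fun j _ => by ring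

theorem formMatrix_mulVec (L : Amb n →L[ℝ] Amb n →L[ℝ] ℝ) (x : Amb n) (i : Fin (n + 1)) :
    (formMatrix L *ᵥ x.ofLp) i = L (EuclideanSpace.single i 1) x := by
  rw [apply_eq_dotProduct, PiLp.ofLp_single, single_one_dotProduct]

theorem vecMul_formMatrix (L : Amb n →L[ℝ] Amb n →L[ℝ] ℝ) (x : Amb n) (i : Fin (n + 1)) :
    (x.ofLp ᵥ* formMatrix L) i = L x (EuclideanSpace.single i 1) := by
  rw [apply_eq_dotProduct, PiLp.ofLp_single, Matrix.dotProduct_mulVec,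
    dotProduct_single_one]

/-- The Gram matrix of a family of vectors for the form `L + v ⊗ v`. -/
theorem gram_eq (L : Amb n →L[ℝ] Amb n →L[ℝ] ℝ) (v : Amb n) (c : Fin (n + 1) → Amb n) :
    Matrix.of (fun i j => L (c i) (c j) + inner ℝ v (c i) * inner ℝ v (c j)) =
      Matrix.of (fun i a => c i a) * (formMatrix L + Matrix.vecMulVec v.ofLp v.ofLp) *
        (Matrix.of fun i a => c i a)ᵀ := by
  ext i j
  rw [Matrix.mul_mul_apply, Matrix.add_mulVec, dotProduct_add, Matrix.vecMulVec_mulVec,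
    Matrix.of_apply, apply_eq_dotProduct, inner_eq_dotProduct, inner_eq_dotProduct]
  simp only [dotProduct_smul]
  rw [dotProduct_comm v.ofLp (c i).ofLp]
  simp only [MulOpposite.smul_eq_mul_unop, MulOpposite.unop_op, Matrix.transpose_transpose]
  rfl

/-- With `p` prepended to the tangent family, the Gram matrix of `h + p ⊗ p` is block diagonal with
first block `1`. -/
theorem det_gram_cons {h : BilinField n} {p : Sphere n} {f : Fin n → Amb n}
    (hh : ∀ p y, h p (p : Amb n) y = 0) (hf : ∀ i, inner ℝ (p : Amb n) (f i) = 0) :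
    (Matrix.of fun i j => h p (f i) (f j)).det =
      (Matrix.of fun i a => (Fin.cons (p : Amb n) f : Fin (n + 1) → Amb n) i a).det ^ 2 *
        gramDet h p := by
  have h1 := congrArg Matrix.det (gram_eq (h p) (p : Amb n) (Fin.cons (p : Amb n) f))
  rw [Matrix.det_mul, Matrix.det_mul, Matrix.det_transpose] at h1
  rw [gramDet, sq, mul_right_comm, ← h1, Matrix.det_succ_row_zero]
  simp only [Matrix.of_apply, Fin.cons_zero, Fin.sum_univ_succ, Fin.cons_succ, hf, hh,
    inner_coe_self]
  simp
  congr 1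
  ext i j
  simp [hf]

theorem finrank_tangent (p : Sphere n) :
    Module.finrank ℝ (Submodule.span ℝ {(p : Amb n)})ᗮ = n := by
  have : Fact (Module.finrank ℝ (Amb n) = n + 1) := ⟨by simp⟩
  exact Submodule.finrank_orthogonal_span_singleton (coe_sphere_ne_zero p)

theorem mem_tangent {p : Sphere n} {w : Amb n} :
    w ∈ (Submodule.span ℝ {(p : Amb n)})ᗮ ↔ inner ℝ (p : Amb n) w = 0 :=
  Submodule.mem_orthogonal_singleton_iff_inner_right

/-- The basis in `volDensity` is chosen separately at each point, with no continuity. `gramDet`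
involves no choice and can be differentiated. -/
theorem volDensity_eq {h : BilinField n} (hh : ∀ p y, h p (p : Amb n) y = 0) (p : Sphere n) :
    volDensity h p = Real.sqrt (gramDet h p) := by
  let b := (stdOrthonormalBasis ℝ (Submodule.span ℝ {(p : Amb n)})ᗮ).reindex
    (finCongr (finrank_tangent p))
  let f : Fin n → Amb n := fun i => b i
  have hf : ∀ i, inner ℝ (p : Amb n) (f i) = 0 := fun i => mem_tangent.mp (b i).2
  have h1 : volDensity h p = Real.sqrt (Matrix.of fun i j => h p (f i) (f j)).det := by
    rw [volDensity, ← Matrix.det_submatrix_equiv_self (finCongr (finrank_tangent p)).symm]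
    congr 2
    ext i j
    simp [f, b]
  have h2 : (Matrix.of fun i a => (Fin.cons (p : Amb n) f : Fin (n + 1) → Amb n) i a).det ^ 2 =
      1 := by
    have h3 : Matrix.of (fun i a => (Fin.cons (p : Amb n) f : Fin (n + 1) → Amb n) i a) *
        (Matrix.of fun i a => (Fin.cons (p : Amb n) f : Fin (n + 1) → Amb n) i a)ᵀ = 1 := by
      ext i j
      have h4 : (Matrix.of (fun i a => (Fin.cons (p : Amb n) f : Fin (n + 1) → Amb n) i a) *
        (Matrix.of fun i a => (Fin.cons (p : Amb n) f : Fin (n + 1) → Amb n) i a)ᵀ) i j =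
          inner ℝ ((Fin.cons (p : Amb n) f : Fin (n + 1) → Amb n) i)
            ((Fin.cons (p : Amb n) f : Fin (n + 1) → Amb n) j) := by
        rw [inner_eq_dotProduct]
        rfl
      rw [h4]
      have h5 := orthonormal_iff_ite.mp b.orthonormal
      refine Fin.cases ?_ (fun i => ?_) i <;> refine Fin.cases ?_ (fun j => ?_) j
      · simp
      · simp [hf, (Fin.succ_ne_zero _).symm]
      · simp [hf, real_inner_comm]
      · simpa [Matrix.one_apply] using h5 i j
    have h4 := congrArg Matrix.det h3
    rwa [Matrix.det_mul, Matrix.det_transpose, Matrix.det_one, ← sq] at h4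
  rw [h1, det_gram_cons hh hf, h2, one_mul]

/-- The restriction of a two-tensor to a tangent space. -/
def tangentForm (h : BilinField n) (p : Sphere n) :
    (Submodule.span ℝ {(p : Amb n)})ᗮ →ₗ[ℝ] (Submodule.span ℝ {(p : Amb n)})ᗮ →ₗ[ℝ] ℝ :=
  LinearMap.mk₂ ℝ (fun x y => h p x y) (by simp) (by simp) (by simp) (by simp)

theorem tangentForm_pos {h : BilinField n} (hp : IsPosDef h) (p : Sphere n)
    (x : (Submodule.span ℝ {(p : Amb n)})ᗮ) (hx : x ≠ 0) : 0 < tangentForm h p x x :=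
  hp p x (mem_tangent.mp x.2) fun h => hx (Subtype.ext h)

theorem gramDet_pos {h : BilinField n} (hh : IsSymTensor h) (hp : IsPosDef h) (p : Sphere n) :
    0 < gramDet h p := by
  obtain ⟨b, hb⟩ := exists_orthonormal_family (finrank_tangent p) (tangentForm h p)
    (fun x y => hh.symm p x y) (tangentForm_pos hp p)
  have h1 := det_gram_cons hh.horizontal (p := p) (f := fun i => (b i : Amb n))
    fun i => mem_tangent.mp (b i).2
  have h2 : (Matrix.of fun i j => h p (b i) (b j)) = 1 := by
    ext i j
    exact hb i j
  rw [h2, Matrix.det_one] at h1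
  exact pos_of_mul_pos_right (h1 ▸ one_pos) (sq_nonneg _)

theorem volDensity_pos {h : BilinField n} (hh : IsSymTensor h) (hp : IsPosDef h) (p : Sphere n) :
    0 < volDensity h p := by
  rw [volDensity_eq hh.horizontal]
  exact Real.sqrt_pos.mpr (gramDet_pos hh hp p)

theorem volDensity_smul (h : BilinField n) (c : Sphere n → ℝ) (p : Sphere n) (hc : 0 < c p) :
    volDensity (fun q => c q • h q) p = c p ^ ((n : ℝ) / 2) * volDensity h p := by
  have h1 : ∀ M : Matrix (Fin (Module.finrank ℝ (Submodule.span ℝ {(p : Amb n)})ᗮ))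
      (Fin (Module.finrank ℝ (Submodule.span ℝ {(p : Amb n)})ᗮ)) ℝ,
      Real.sqrt (c p • M).det = c p ^ ((n : ℝ) / 2) * Real.sqrt M.det := by
    intro M
    have h2 : c p ^ Module.finrank ℝ (Submodule.span ℝ {(p : Amb n)})ᗮ = c p ^ n := by
      rw [finrank_tangent]
    rw [Matrix.det_smul, Fintype.card_fin, h2, Real.sqrt_mul (by positivity),
      Real.sqrt_eq_rpow, ← Real.rpow_natCast, ← Real.rpow_mul hc.le]
    congr 2
    ring
  rw [volDensity, volDensity, ← h1]
  rfl

theorem gramDet_pullback_phi {h : BilinField n} (hh : IsSymTensor h) (T : GLn n) (p : Sphere n) :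
    gramDet (pullback (phi T) h) p =
      ((‖act T.1 (p : Amb n)‖ ^ (n + 1))⁻¹ * T.1.det) ^ 2 * gramDet h (phi T p) := by
  set N := ‖act T.1 (p : Amb n)‖
  have hN : N ≠ 0 := norm_ne_zero_iff.mpr (act_ne_zero T p)
  set q := phi T p
  set A := formMatrix (pullback (phi T) h p)
  have hA : A = (N ^ 2)⁻¹ • (T.1ᵀ * formMatrix (h q) * T.1) := by
    ext i j
    have hc : ∀ i, (act T.1 (EuclideanSpace.single i 1)).ofLp = T.1ᵀ i := fun i => by
      rw [Matrix.ofLp_toEuclideanCLM, PiLp.ofLp_single, Matrix.mulVec_single_one]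
      rfl
    rw [Matrix.smul_apply, Matrix.mul_mul_apply, ← hc, ← hc, ← apply_eq_dotProduct]
    exact pullback_phi_apply hh T p _ _
  have hp1 := pullback_phi_horizontal hh T p
  have hp0 : ∀ x, pullback (phi T) h p x p = 0 := fun x => by
    rw [pullback_phi_apply hh, hh.symm, ← pullback_phi_apply hh, hp1]
  -- The scaling is chosen so that `u ⊗ u` is `N⁻²` times the pull-back of `q ⊗ q` by `T`; then `u ·
  -- p = 1` holds as well.
  let u : Fin (n + 1) → ℝ := N⁻¹ • (T.1ᵀ *ᵥ (q : Amb n).ofLp)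
  have hu : u ⬝ᵥ (p : Amb n).ofLp = 1 := by
    have h1 : (T.1ᵀ *ᵥ (q : Amb n).ofLp) ⬝ᵥ (p : Amb n).ofLp = N := by
      change (act T.1ᵀ (q : Amb n)).ofLp ⬝ᵥ (p : Amb n).ofLp = N
      rw [← inner_eq_dotProduct, inner_act_transpose, act_eq_smul_phi, inner_smul_right,
        inner_coe_self, mul_one]
    rw [smul_dotProduct, h1, smul_eq_mul, inv_mul_cancel₀ hN]
  have hAu : A + Matrix.vecMulVec u u = (N ^ 2)⁻¹ • (T.1ᵀ *
      (formMatrix (h q) + Matrix.vecMulVec (q : Amb n).ofLp (q : Amb n).ofLp) * T.1) := by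
    rw [hA, mul_add, add_mul, smul_add, Matrix.mul_vecMulVec, Matrix.vecMulVec_mul,
      ← Matrix.mulVec_transpose, Matrix.smul_vecMulVec, Matrix.vecMulVec_smul, smul_smul]
    congr 2
    field_simp
  rw [gramDet, ← det_add_vecMulVec_eq A _ u ?_ ?_ ?_ hu, hAu, Matrix.det_smul, Matrix.det_mul,
    Matrix.det_mul, Matrix.det_transpose, Fintype.card_fin, gramDet]
  · ring
  · ext i
    rw [formMatrix_mulVec]
    exact hp0 _
  · ext i
    rw [vecMul_formMatrix]
    exact hp1 _
  · rw [← inner_eq_dotProduct, inner_coe_self]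

theorem volDensity_pullback_phi {h : BilinField n} (hh : IsSymTensor h) (T : GLn n)
    (p : Sphere n) : volDensity (pullback (phi T) h) p =
      (‖act T.1 (p : Amb n)‖ ^ (n + 1))⁻¹ * |T.1.det| * volDensity h (phi T p) := by
  rw [volDensity_eq (pullback_phi_horizontal hh T), volDensity_eq hh.horizontal, gramDet_pullback_phi hh, Real.sqrt_mul (sq_nonneg _),
    Real.sqrt_sq_eq_abs, abs_mul, abs_of_nonneg (by positivity)]

theorem toKilling_apply (g : BilinField n) (p : Sphere n) (x y : Amb n) :
    toKilling g p x y = (metricFactor g p)⁻¹ * g p x y := rfl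

theorem toMetric_apply (k : BilinField n) (p : Sphere n) (x y : Amb n) :
    toMetric k p x y = (killingFactor k p)⁻¹ * k p x y := rfl

theorem metricFactor_pos {g : BilinField n} (hg : ∀ p, 0 < volDensity g p) (p : Sphere n) :
    0 < metricFactor g p :=
  Real.rpow_pos_of_pos (hg p) _

theorem killingFactor_pos {k : BilinField n} (hk : ∀ p, 0 < volDensity k p) (p : Sphere n) :
    0 < killingFactor k p :=
  Real.rpow_pos_of_pos (hk p) _

/-- The density of `g / F` is `F^(-n/2) F^((n+1)/4) = F^(-(n-1)/4)`. -/
theorem killingFactor_toKilling (hn : 2 ≤ n) {g : BilinField n} (hg : ∀ p, 0 < volDensity g p)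
    (p : Sphere n) : killingFactor (toKilling g) p = (metricFactor g p)⁻¹ := by
  have hv := hg p
  have h1 := volDensity_smul g (fun q => (metricFactor g q)⁻¹) p
    (inv_pos.mpr (metricFactor_pos hg p))
  have hn' : (2 : ℝ) ≤ n := by exact_mod_cast hn
  have h3 : (n : ℝ) - 1 ≠ 0 := by linarith
  have h4 : (n : ℝ) + 1 ≠ 0 := by linarith
  rw [killingFactor]
  change volDensity (fun q => (metricFactor g q)⁻¹ • g q) p ^ _ = _
  rw [h1, metricFactor, ← Real.rpow_neg hv.le, ← Real.rpow_mul hv.le,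
    ← Real.rpow_add_one hv.ne', ← Real.rpow_mul hv.le]
  congr 1
  field_simp
  ring

theorem metricFactor_toMetric (hn : 2 ≤ n) {k : BilinField n} (hk : ∀ p, 0 < volDensity k p)
    (p : Sphere n) : metricFactor (toMetric k) p = (killingFactor k p)⁻¹ := by
  have hv := hk p
  have h1 := volDensity_smul k (fun q => (killingFactor k q)⁻¹) p
    (inv_pos.mpr (killingFactor_pos hk p))
  have hn' : (2 : ℝ) ≤ n := by exact_mod_cast hn
  have h3 : (n : ℝ) - 1 ≠ 0 := by linarith
  have h4 : (n : ℝ) + 1 ≠ 0 := by linarith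
  rw [metricFactor]
  change volDensity (fun q => (killingFactor k q)⁻¹ • k q) p ^ _ = _
  rw [h1, killingFactor, ← Real.rpow_neg hv.le, ← Real.rpow_mul hv.le,
    ← Real.rpow_add_one hv.ne', ← Real.rpow_mul hv.le]
  congr 1
  field_simp
  ring

theorem toMetric_toKilling (hn : 2 ≤ n) {g : BilinField n} (hg : ∀ p, 0 < volDensity g p) :
    toMetric (toKilling g) = g := by
  ext p x y
  rw [toMetric_apply, toKilling_apply, killingFactor_toKilling hn hg, inv_inv,
    mul_inv_cancel_left₀ (metricFactor_pos hg p).ne']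

theorem toKilling_toMetric (hn : 2 ≤ n) {k : BilinField n} (hk : ∀ p, 0 < volDensity k p) :
    toKilling (toMetric k) = k := by
  ext p x y
  rw [toKilling_apply, toMetric_apply, metricFactor_toMetric hn hk, inv_inv,
    mul_inv_cancel_left₀ (killingFactor_pos hk p).ne']

/-- The factor of `φ(T)^* g` is `|Tp|⁻⁴ |det T|^(4/(n+1))` times that of `g` at `φ(T) p`, while the
tensor itself acquires `|Tp|⁻²`; the quotient is the scalar of `tensorAct`. Minimality plays no
role. -/
theorem toKilling_pullback_phi {g : BilinField n} (hg : IsRiemannianMetric g) (T : GLn n) :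
    toKilling (pullback (phi T) g) = tensorAct T (toKilling g) := by
  ext p x y
  have hN : 0 < ‖act T.1 (p : Amb n)‖ := norm_pos_iff.mpr (act_ne_zero T p)
  have hd := abs_det_pos T
  have hv := volDensity_pos hg.1 hg.2 (phi T p)
  have hn : (n : ℝ) + 1 ≠ 0 := by positivity
  have h1 : (‖act T.1 (p : Amb n)‖ ^ (n + 1)) ^ (4 / ((n : ℝ) + 1)) =
      ‖act T.1 (p : Amb n)‖ ^ 4 := by
    rw [← Real.rpow_natCast, ← Real.rpow_natCast _ 4, ← Real.rpow_mul hN.le]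
    congr 1
    push_cast
    field_simp
  rw [toKilling_apply, tensorAct_apply, toKilling_apply, pullback_phi_apply hg.1, metricFactor,
    metricFactor, volDensity_pullback_phi hg.1 T, Real.mul_rpow (by positivity) hv.le,
    Real.mul_rpow (by positivity) hd.le, Real.inv_rpow (by positivity), h1, Real.rpow_neg hd.le]
  field_simp

/-- Read from right to left, this shows that pull-back preserves minimality of the equators, without
following the equators under `φ(T)`. -/
theorem toMetric_tensorAct (hn : 2 ≤ n) {g : BilinField n} (hg : IsRiemannianMetric g)
    (T : GLn n) : toMetric (tensorAct T (toKilling g)) = pullback (phi T) g := by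
  rw [← toKilling_pullback_phi hg, toMetric_toKilling hn]
  intro p
  have hN : 0 < ‖act T.1 (p : Amb n)‖ := norm_pos_iff.mpr (act_ne_zero T p)
  have hd := abs_det_pos T
  have hv := volDensity_pos hg.1 hg.2 (phi T p)
  rw [volDensity_pullback_phi hg.1]
  positivity

end Volume

/-! ### Smoothness of the conformal factors. -/

section Smoothness

variable {n : ℕ} {F : Type*} [NormedAddCommGroup F] [NormedSpace ℝ F]

theorem SmoothOnSphere.contDiffAt {f : Sphere n → F} (hf : SmoothOnSphere f) {z : Amb n}
    (hz : z ≠ 0) : ContDiffAt ℝ ∞ (radialExt f) z :=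
  ContDiffOn.contDiffAt hf (isOpen_compl_singleton.mem_nhds hz)

theorem SmoothOnSphere.hasFDerivAt {f : Sphere n → F} (hf : SmoothOnSphere f) (p : Sphere n) :
    HasFDerivAt (radialExt f) (fderiv ℝ (radialExt f) (p : Amb n)) (p : Amb n) :=
  (differentiableAt_radialExt hf p).hasFDerivAt

theorem smoothOnSphere_coe : SmoothOnSphere fun p : Sphere n => (p : Amb n) := by
  intro x hx
  have hx' : x ≠ 0 := hx
  have hn : ContDiffAt ℝ ∞ (fun y : Amb n => ‖y‖⁻¹ • y) x :=
    ((contDiffAt_norm ℝ hx').inv (norm_ne_zero_iff.mpr hx')).smul contDiffAt_id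
  refine hn.contDiffWithinAt.congr_of_mem (fun y hy => ?_) hx
  have hy' : y ≠ 0 := hy
  rw [radialExt, dif_neg hy', radialProj]

theorem smoothOnSphere_comp {f : Sphere n → ℝ} (hf : SmoothOnSphere f) {φ : ℝ → F}
    (hφ : ∀ p, ContDiffAt ℝ ∞ φ (f p)) : SmoothOnSphere fun p => φ (f p) := by
  intro x hx
  have hx' : x ≠ 0 := hx
  have he : ∀ y ∈ ({0}ᶜ : Set (Amb n)), radialExt (fun p => φ (f p)) y = φ (radialExt f y) := by
    intro y hy
    have hy' : y ≠ 0 := hy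
    rw [radialExt, radialExt, dif_neg hy', dif_neg hy']
  have h1 : ContDiffAt ℝ ∞ φ (radialExt f x) := by
    rw [radialExt, dif_neg hx']
    exact hφ _
  exact (h1.comp x (hf.contDiffAt hx')).contDiffWithinAt.congr_of_mem he hx

theorem radialExt_smul_fun (c : Sphere n → ℝ) (f : Sphere n → F) :
    radialExt (fun p => c p • f p) = fun z => radialExt c z • radialExt f z := by
  funext z
  by_cases hz : z = 0 <;> simp [radialExt, hz]

theorem SmoothOnSphere.smul {c : Sphere n → ℝ} {f : Sphere n → F} (hc : SmoothOnSphere c)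
    (hf : SmoothOnSphere f) : SmoothOnSphere fun p => c p • f p := by
  unfold SmoothOnSphere
  rw [radialExt_smul_fun]
  exact ContDiffOn.smul hc hf

theorem contDiff_det {m : Type*} [Fintype m] [DecidableEq m] :
    ContDiff ℝ ∞ fun A : m → m → ℝ => (Matrix.of A).det := by
  simp only [Matrix.det_apply, Matrix.of_apply]
  fun_prop

theorem radialExt_gramDet (h : BilinField n) {z : Amb n} (hz : z ≠ 0) :
    radialExt (gramDet h) z = (formMatrix (radialExt h z) +
      Matrix.vecMulVec (radialExt (fun p : Sphere n => (p : Amb n)) z).ofLp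
        (radialExt (fun p : Sphere n => (p : Amb n)) z).ofLp).det := by
  simp only [radialExt, dif_neg hz, gramDet]

theorem smoothOnSphere_gramDet {h : BilinField n} (hh : SmoothOnSphere h) :
    SmoothOnSphere (gramDet h) := by
  intro x hx
  have hx' : x ≠ 0 := hx
  have h1 := hh.contDiffAt hx'
  have h2 := smoothOnSphere_coe.contDiffAt hx'
  have hM : ContDiffAt ℝ ∞ (fun z i j => radialExt h z (EuclideanSpace.single i 1)
      (EuclideanSpace.single j 1) + (radialExt (fun p : Sphere n => (p : Amb n)) z) i *
        (radialExt (fun p : Sphere n => (p : Amb n)) z) j) x := by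
    rw [contDiffAt_pi]
    intro i
    rw [contDiffAt_pi]
    intro j
    have hc : ∀ i : Fin (n + 1), ContDiffAt ℝ ∞
        (fun z => (radialExt (fun p : Sphere n => (p : Amb n)) z) i) x := fun i =>
      ((EuclideanSpace.proj i : Amb n →L[ℝ] ℝ).contDiff.contDiffAt).comp x h2
    exact ((h1.clm_apply contDiffAt_const).clm_apply contDiffAt_const).add ((hc i).mul (hc j))
  refine (contDiff_det.contDiffAt.comp x hM).contDiffWithinAt.congr_of_mem (fun z hz => ?_) hx
  rw [radialExt_gramDet h hz]
  rfl

theorem smoothOnSphere_volDensity_rpow {h : BilinField n} (hh : IsRiemannianMetric h) (r : ℝ) :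
    SmoothOnSphere fun p => (volDensity h p ^ r)⁻¹ := by
  have h1 : (fun p => (volDensity h p ^ r)⁻¹) = fun p => (Real.sqrt (gramDet h p) ^ r)⁻¹ := by
    funext p
    rw [volDensity_eq hh.1.horizontal]
  rw [h1]
  refine smoothOnSphere_comp (φ := fun s => (Real.sqrt s ^ r)⁻¹)
    (smoothOnSphere_gramDet hh.1.smooth) fun p => ?_
  have h2 := gramDet_pos hh.1 hh.2 p
  have h3 : Real.sqrt (gramDet h p) ≠ 0 := (Real.sqrt_pos.mpr h2).ne'
  exact ((Real.contDiffAt_sqrt h2.ne').rpow_const_of_ne h3).inv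
    (Real.rpow_pos_of_pos (Real.sqrt_pos.mpr h2) r).ne'

theorem isRiemannianMetric_smul {g : BilinField n} (hg : IsRiemannianMetric g)
    {c : Sphere n → ℝ} (hc : SmoothOnSphere c) (hpos : ∀ p, 0 < c p) :
    IsRiemannianMetric fun p => c p • g p := by
  refine ⟨⟨hc.smul hg.1.smooth, fun p x y => ?_, fun p y => ?_⟩, fun p w hw hw0 => ?_⟩
  · simp [hg.1.symm p x y]
  · simp [hg.1.horizontal]
  · exact mul_pos (hpos p) (hg.2 p w hw hw0)

theorem isRiemannianMetric_toKilling {g : BilinField n} (hg : IsRiemannianMetric g) :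
    IsRiemannianMetric (toKilling g) :=
  isRiemannianMetric_smul hg (smoothOnSphere_volDensity_rpow hg _) fun p =>
    inv_pos.mpr (Real.rpow_pos_of_pos (volDensity_pos hg.1 hg.2 p) _)

theorem isRiemannianMetric_toMetric {k : BilinField n} (hk : IsRiemannianMetric k) :
    IsRiemannianMetric (toMetric k) :=
  isRiemannianMetric_smul hk (smoothOnSphere_volDensity_rpow hk _) fun p =>
    inv_pos.mpr (Real.rpow_pos_of_pos (volDensity_pos hk.1 hk.2 p) _)

end Smoothness

/-! ### The Killing condition as a first-order equation. -/

section Geodesics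

variable {n : ℕ}

theorem hasDerivAt_geodesic (p : Sphere n) (w : Amb n) (hw : ‖w‖ = 1)
    (hpw : inner ℝ (p : Amb n) w = 0) (t : ℝ) :
    HasDerivAt (fun s => (geodesic p w hw hpw s : Amb n)) (velocity p w t) t :=
  ((Real.hasDerivAt_cos t).smul_const _).add ((Real.hasDerivAt_sin t).smul_const _)

theorem hasDerivAt_velocity (p : Sphere n) (w : Amb n) (hw : ‖w‖ = 1)
    (hpw : inner ℝ (p : Amb n) w = 0) (t : ℝ) :
    HasDerivAt (velocity p w) (-(geodesic p w hw hpw t : Amb n)) t := by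
  have h := (((Real.hasDerivAt_sin t).neg.smul_const (p : Amb n)).add
    ((Real.hasDerivAt_cos t).smul_const w))
  have e : -(geodesic p w hw hpw t : Amb n) =
      (-Real.cos t) • (p : Amb n) + (-Real.sin t) • w := by
    simp only [geodesic]
    module
  rw [e]
  exact h

/-- The acceleration of a great circle is normal, so `k` annihilates it and only the derivative of
`k` survives. -/
theorem hasDerivAt_along_geodesic {k : BilinField n} (hk : IsSymTensor k) (p : Sphere n)
    (w : Amb n) (hw : ‖w‖ = 1) (hpw : inner ℝ (p : Amb n) w = 0) (t : ℝ) :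
    HasDerivAt (fun s => k (geodesic p w hw hpw s) (velocity p w s) (velocity p w s))
      (dirDeriv k (geodesic p w hw hpw t) (velocity p w t) (velocity p w t) (velocity p w t))
      t := by
  have h1 := (hk.smooth.hasFDerivAt (geodesic p w hw hpw t)).comp_hasDerivAt t
    (hasDerivAt_geodesic p w hw hpw t)
  have h2 := hasDerivAt_velocity p w hw hpw t
  have h3 : HasDerivAt (fun s => radialExt k (geodesic p w hw hpw s : Amb n) (velocity p w s)
      (velocity p w s)) _ t := (h1.clm_apply h2).clm_apply h2
  simp only [radialExt_coe] at h3
  convert h3 using 1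
  simp [dirDeriv, radialExt_coe, hk.horizontal, hk.horizontal_right]

theorem isConstAlongGeodesics_iff {k : BilinField n} (hk : IsSymTensor k) :
    IsConstAlongGeodesics k ↔
      ∀ (p : Sphere n) (w : Amb n), inner ℝ (p : Amb n) w = 0 → dirDeriv k p w w w = 0 := by
  constructor
  · intro h p w hpw
    by_cases hw0 : w = 0
    · simp [hw0]
    have hn := norm_ne_zero_iff.mpr hw0
    have hw : ‖‖w‖⁻¹ • w‖ = 1 := by
      rw [norm_smul, norm_inv, norm_norm, inv_mul_cancel₀ hn]
    have hpw' : inner ℝ (p : Amb n) (‖w‖⁻¹ • w) = 0 := by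
      rw [inner_smul_right, hpw, mul_zero]
    have h1 := hasDerivAt_along_geodesic hk p _ hw hpw' 0
    have h2 : (fun s => k (geodesic p _ hw hpw' s) (velocity p (‖w‖⁻¹ • w) s)
        (velocity p (‖w‖⁻¹ • w) s)) = fun _ => k (geodesic p _ hw hpw' 0)
          (velocity p (‖w‖⁻¹ • w) 0) (velocity p (‖w‖⁻¹ • w) 0) :=
      funext fun s => h p _ hw hpw' s 0
    rw [h2] at h1
    have h3 := h1.unique (hasDerivAt_const _ _)
    have hg0 : geodesic p _ hw hpw' 0 = p := Subtype.ext (by simp [geodesic])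
    have hv0 : velocity p (‖w‖⁻¹ • w) 0 = ‖w‖⁻¹ • w := by simp [velocity]
    rw [hg0, hv0] at h3
    simpa [dirDeriv, hw0] using h3
  · intro h p w hw hpw s t
    refine is_const_of_deriv_eq_zero
      (fun r => (hasDerivAt_along_geodesic hk p w hw hpw r).differentiableAt) (fun r => ?_) s t
    rw [(hasDerivAt_along_geodesic hk p w hw hpw r).deriv]
    apply h
    have h4 : ‖(p : Amb n)‖ = 1 := norm_coe_sphere p
    have h5 : inner ℝ w (p : Amb n) = 0 := by rw [real_inner_comm, hpw]
    simp only [geodesic, velocity, inner_add_left, inner_add_right, real_inner_smul_left,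
      real_inner_smul_right, real_inner_self_eq_norm_sq, hw, h4, hpw, h5]
    ring

end Geodesics

/-! ### The derivative of the determinant at the identity. -/

section Jacobi

/-- Jacobi's formula at the identity matrix. -/
theorem hasDerivAt_det_of_eq_one {m : Type*} [Fintype m] [DecidableEq m] {M : ℝ → m → m → ℝ}
    {M' : m → m → ℝ} {t : ℝ} (hM : ∀ i j, HasDerivAt (fun s => M s i j) (M' i j) t)
    (h1 : Matrix.of (M t) = 1) :
    HasDerivAt (fun s => (Matrix.of (M s)).det) (∑ i, M' i i) t := by
  let D : (m → m → ℝ) → ℝ := fun A => (Matrix.of A).det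
  have hD : HasFDerivAt D (fderiv ℝ D (M t)) (M t) :=
    (contDiff_det.differentiable (by simp)).differentiableAt.hasFDerivAt
  have hM' : HasDerivAt M M' t := by
    rw [hasDerivAt_pi]
    intro i
    rw [hasDerivAt_pi]
    exact hM i
  have h2 := hD.comp_hasDerivAt t hM'
  -- The Fréchet derivative of `det` in the direction `M'` is read off along a straight line, where
  -- `det (1 + r M')` is a polynomial in `r` with linear coefficient `trace M'`.
  have hl : HasDerivAt (fun r : ℝ => M t + r • M') M' 0 := by
    simpa using ((hasDerivAt_id (0 : ℝ)).smul_const M').const_add (M t)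
  have hD0 : HasFDerivAt D (fderiv ℝ D (M t)) (M t + (0 : ℝ) • M') := by simpa using hD
  have h3 := hD0.comp_hasDerivAt (0 : ℝ) hl
  have h4 : D ∘ (fun r : ℝ => M t + r • M') = fun r => 1 + (Matrix.of M').trace * r +
      (Matrix.det (1 + (Polynomial.X : Polynomial ℝ) •
        (Matrix.of M').map Polynomial.C)).divX.divX.eval r * r ^ 2 := by
    funext r
    rw [← Matrix.det_one_add_smul, ← h1]
    rfl
  rw [h4] at h3
  have h5 := ((hasDerivAt_id (0 : ℝ)).const_mul (Matrix.of M').trace).const_add (1 : ℝ)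
  have h6 := (Polynomial.hasDerivAt (Matrix.det (1 + (Polynomial.X : Polynomial ℝ) •
        (Matrix.of M').map Polynomial.C)).divX.divX 0).mul (hasDerivAt_pow 2 (0 : ℝ))
  have h7 := h3.unique (h5.add h6)
  simp at h7
  have h8 : ∑ i, M' i i = fderiv ℝ D (M t) M' := h7.symm
  rw [h8]
  exact h2

end Jacobi

/-! ### The derivative of the Gram determinant. -/

section DerivVolume

variable {n : ℕ}

theorem dirDeriv_coe_inner (p : Sphere n) (x : Amb n) :
    inner ℝ (p : Amb n) (dirDeriv (fun q : Sphere n => (q : Amb n)) p x) = 0 := by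
  have hd := smoothOnSphere_coe.hasFDerivAt p
  have h := (hd.inner ℝ hd)
  have he : (fun z : Amb n => (inner ℝ (radialExt (fun q : Sphere n => (q : Amb n)) z)
      (radialExt (fun q : Sphere n => (q : Amb n)) z) : ℝ)) =ᶠ[nhds (p : Amb n)] fun _ => 1 := by
    filter_upwards [isOpen_compl_singleton.mem_nhds (coe_sphere_ne_zero p)] with z hz
    have hz' : z ≠ 0 := hz
    rw [radialExt, dif_neg hz', inner_coe_self]
  have h3 := congrArg (fun L : Amb n →L[ℝ] ℝ => L x)
    ((h.congr_of_eventuallyEq he.symm).unique (hasFDerivAt_const (1 : ℝ) (p : Amb n)))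
  simp [radialExt_coe] at h3
  rw [real_inner_comm] at h3 ⊢
  rw [dirDeriv]
  linarith

/-- Differentiate `h(ρ, p) = 0`, where `ρ` is the radial projection; the term with the derivative of
`ρ` drops out because `h p` annihilates `p`. -/
theorem dirDeriv_horizontal {h : BilinField n} (hh : IsSymTensor h) (p : Sphere n)
    (x : Amb n) : dirDeriv h p x p p = 0 := by
  have hd := (((hh.smooth.hasFDerivAt p).clm_apply (smoothOnSphere_coe.hasFDerivAt p)).clm_apply
    (hasFDerivAt_const (p : Amb n) (p : Amb n)))
  have he : (fun z => radialExt h z (radialExt (fun q : Sphere n => (q : Amb n)) z) (p : Amb n)) =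
      fun _ => 0 := by
    funext z
    by_cases hz : z = 0
    · simp [radialExt, hz]
    · simp only [radialExt, dif_neg hz, hh.horizontal]
  rw [he] at hd
  have h3 := congrArg (fun L : Amb n →L[ℝ] ℝ => L x) (hd.unique (hasFDerivAt_const (0 : ℝ) _))
  simpa [radialExt_coe, hh.horizontal_right, dirDeriv] using h3

/-- The logarithmic derivative of the Gram determinant is the trace of the derivative. -/
theorem dirDeriv_gramDet {g : BilinField n} (hg : IsSymTensor g) {p : Sphere n}
    {f : Fin n → Amb n} (hf : ∀ i, inner ℝ (p : Amb n) (f i) = 0)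
    (hfg : ∀ i j, g p (f i) (f j) = if i = j then 1 else 0) (x : Amb n) :
    dirDeriv (gramDet g) p x = gramDet g p * ∑ i, dirDeriv g p x (f i) (f i) := by
  let c : Fin (n + 1) → Amb n := Fin.cons (p : Amb n) f
  let ρ : Amb n → Amb n := radialExt fun q : Sphere n => (q : Amb n)
  -- This line may leave the sphere, but radial extensions see only its radial projection.
  let z : ℝ → Amb n := fun t => (p : Amb n) + t • x
  have hz0 : z 0 = p := by simp [z]
  have hz : HasDerivAt z x 0 := by
    have h := ((hasDerivAt_id (0 : ℝ)).smul_const x).const_add (p : Amb n)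
    rw [one_smul] at h
    exact h
  have hcomp : ∀ {F : Type} [NormedAddCommGroup F] [NormedSpace ℝ F] {u : Sphere n → F},
      SmoothOnSphere u → HasDerivAt (fun t => radialExt u (z t)) (dirDeriv u p x) 0 := by
    intro F _ _ u hu
    have h := hu.hasFDerivAt p
    rw [← hz0] at h
    have h2 := h.comp_hasDerivAt (0 : ℝ) hz
    rw [hz0] at h2
    exact h2
  -- The Gram matrix of `g + ρ ⊗ ρ` along the line in the fixed frame `(p, f)`. It is the identity
  -- at `t = 0`, and its determinant is a constant times the Gram determinant of `g`.
  let M : ℝ → Fin (n + 1) → Fin (n + 1) → ℝ := fun t i j =>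
    radialExt g (z t) (c i) (c j) + inner ℝ (ρ (z t)) (c i) * inner ℝ (ρ (z t)) (c j)
  have hg' := hcomp hg.smooth
  have hρ := hcomp (smoothOnSphere_coe (n := n))
  set u := dirDeriv (fun q : Sphere n => (q : Amb n)) p x with hu
  have hM : ∀ i j, HasDerivAt (fun t => M t i j) (dirDeriv g p x (c i) (c j) +
      (inner ℝ u (c i) * inner ℝ (p : Amb n) (c j) +
        inner ℝ (p : Amb n) (c i) * inner ℝ u (c j))) 0 := by
    intro i j
    have h1 := (hg'.clm_apply (hasDerivAt_const (0 : ℝ) (c i))).clm_apply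
      (hasDerivAt_const (0 : ℝ) (c j))
    have h2 : ∀ i, HasDerivAt (fun t => (inner ℝ (ρ (z t)) (c i) : ℝ)) (inner ℝ u (c i)) 0 := by
      intro i
      simpa using hρ.inner ℝ (hasDerivAt_const (0 : ℝ) (c i))
    have h3 := h1.add ((h2 i).mul (h2 j))
    simp only [hz0, ρ, radialExt_coe, map_zero, add_zero] at h3
    exact h3
  have hM1 : Matrix.of (M 0) = 1 := by
    ext i j
    simp only [M, hz0, ρ, radialExt_coe, Matrix.of_apply]
    refine Fin.cases ?_ (fun i => ?_) i <;> refine Fin.cases ?_ (fun j => ?_) j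
    · simp [c, hg.horizontal]
    · simp [c, hf, hg.horizontal, (Fin.succ_ne_zero _).symm]
    · simp [c, hf, hg.horizontal_right]
    · simp [c, hf, hfg, Matrix.one_apply]
  have hdet := hasDerivAt_det_of_eq_one hM hM1
  let P : Matrix (Fin (n + 1)) (Fin (n + 1)) ℝ := Matrix.of fun i a => c i a
  have hMP : ∀ t, z t ≠ 0 → (Matrix.of (M t)).det = P.det ^ 2 * radialExt (gramDet g) (z t) := by
    intro t ht
    have h1 := congrArg Matrix.det (gram_eq (radialExt g (z t)) (ρ (z t)) c)
    rw [Matrix.det_mul, Matrix.det_mul, Matrix.det_transpose] at h1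
    rw [radialExt_gramDet g ht, sq, mul_right_comm]
    exact h1
  have hev : (fun t => (Matrix.of (M t)).det) =ᶠ[nhds 0]
      fun t => P.det ^ 2 * radialExt (gramDet g) (z t) := by
    have h1 : ∀ᶠ t in nhds (0 : ℝ), z t ≠ 0 :=
      hz.continuousAt.eventually_ne (by rw [hz0]; exact coe_sphere_ne_zero p)
    filter_upwards [h1] with t ht using hMP t ht
  have h2 := ((hcomp (smoothOnSphere_gramDet hg.smooth)).const_mul (P.det ^ 2)).congr_of_eventuallyEq
    hev
  have h3 := hdet.unique h2
  have h4 : P.det ^ 2 * gramDet g p = 1 := by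
    have h5 := hMP 0 (by rw [hz0]; exact coe_sphere_ne_zero p)
    rw [hM1, Matrix.det_one, hz0, radialExt_coe] at h5
    exact h5.symm
  have h6 : inner ℝ u (p : Amb n) = 0 := by
    rw [real_inner_comm]
    exact dirDeriv_coe_inner p x
  simp only [Fin.sum_univ_succ, c, Fin.cons_zero, Fin.cons_succ, hf, h6, mul_zero, zero_mul,
    add_zero, dirDeriv_horizontal hg, zero_add] at h3
  rw [h3]
  linear_combination (-dirDeriv (gramDet g) p x) * h4

end DerivVolume

/-! ### The second fundamental form of an equator in terms of the derivative of the metric. -/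

section SecondFundForm

variable {n : ℕ}

/-- The nondegenerate extension `h + p ⊗ p` of a bilinear form on the tangent space at `p`. -/
def extForm (L : Amb n →L[ℝ] Amb n →L[ℝ] ℝ) (v : Amb n) : Amb n →L[ℝ] Amb n →L[ℝ] ℝ :=
  L + (innerSL ℝ v).smulRight (innerSL ℝ v)

theorem extForm_apply (L : Amb n →L[ℝ] Amb n →L[ℝ] ℝ) (v x y : Amb n) :
    extForm L v x y = L x y + inner ℝ v x * inner ℝ v y := by
  simp [extForm]

theorem exists_equiv_extForm {g : BilinField n} (hg : IsRiemannianMetric g) (p : Sphere n) :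
    ∃ e : Amb n ≃L[ℝ] (Amb n →L[ℝ] ℝ), (e : Amb n →L[ℝ] Amb n →L[ℝ] ℝ) = extForm (g p) p := by
  have inj : Function.Injective (extForm (g p) (p : Amb n)).toLinearMap := by
    rw [← LinearMap.ker_eq_bot, LinearMap.ker_eq_bot']
    intro x hx
    have hx' : ∀ y, g p x y + inner ℝ (p : Amb n) x * inner ℝ (p : Amb n) y = 0 := fun y => by
      rw [← extForm_apply]
      exact congrArg (fun L : Amb n →L[ℝ] ℝ => L y) hx
    have h1 := hx' p
    rw [hg.1.horizontal_right, inner_coe_self, zero_add, mul_one] at h1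
    have h2 := hx' x
    rw [h1, zero_mul, add_zero] at h2
    by_contra hne
    exact (hg.2 p x h1 hne).ne' h2
  have hfin : Module.finrank ℝ (Amb n) = Module.finrank ℝ (Amb n →L[ℝ] ℝ) := by
    rw [← (LinearMap.toContinuousLinearMap (𝕜 := ℝ) (E := Amb n) (F' := ℝ)).finrank_eq]
    exact (Subspace.dual_finrank_eq (K := ℝ) (V := Amb n)).symm
  have : FiniteDimensional ℝ (Amb n →L[ℝ] ℝ) :=
    (LinearMap.toContinuousLinearMap (𝕜 := ℝ) (E := Amb n) (F' := ℝ)).finiteDimensional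
  exact ⟨(LinearMap.linearEquivOfInjective _ inj hfin).toContinuousLinearEquiv, by ext; rfl⟩

theorem gradHeight_spec {g : BilinField n} (hg : IsRiemannianMetric g) (v : Amb n) (p : Sphere n) :
    inner ℝ (p : Amb n) (gradHeight g v p) = 0 ∧
      ∀ z, inner ℝ (p : Amb n) z = 0 → g p (gradHeight g v p) z = inner ℝ v z :=
  sharp_spec hg p (innerSL ℝ v).toLinearMap

theorem tangent_ext {g : BilinField n} (hg : IsRiemannianMetric g) {p : Sphere n} {x y : Amb n}
    (hx : inner ℝ (p : Amb n) x = 0) (hy : inner ℝ (p : Amb n) y = 0)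
    (h : ∀ z, inner ℝ (p : Amb n) z = 0 → g p x z = g p y z) : x = y := by
  by_contra hne
  have h1 : inner ℝ (p : Amb n) (x - y) = 0 := by rw [inner_sub_right, hx, hy, sub_zero]
  have h2 := hg.2 p (x - y) h1 (sub_ne_zero.mpr hne)
  have h3 := h (x - y) h1
  rw [map_sub (g p) x y, sub_apply, h3, sub_self] at h2
  exact lt_irrefl _ h2

/-- The gradient is defined by choice at each point, but it solves the linear equation of the
invertible form `g + ρ ⊗ ρ` with right-hand side `v - ⟪v, ρ⟫ ρ`, and inversion is smooth. -/
theorem differentiableAt_gradHeight {g : BilinField n} (hg : IsRiemannianMetric g) (v : Amb n)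
    (p : Sphere n) : DifferentiableAt ℝ (radialExt (gradHeight g v)) (p : Amb n) := by
  let ρ : Amb n → Amb n := radialExt fun q : Sphere n => (q : Amb n)
  have hρ : DifferentiableAt ℝ ρ (p : Amb n) := differentiableAt_radialExt smoothOnSphere_coe p
  have hic : ContDiffAt ℝ ∞ (fun z => innerSL ℝ (ρ z)) (p : Amb n) :=
    (innerSL ℝ (E := Amb n)).contDiff.contDiffAt.comp (p : Amb n)
      (smoothOnSphere_coe.contDiffAt (coe_sphere_ne_zero p))
  have hi := hic.differentiableAt (by simp)
  have hB : ContDiffAt ℝ ∞ (fun z => extForm (radialExt g z) (ρ z)) (p : Amb n) :=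
    (hg.1.smooth.contDiffAt (coe_sphere_ne_zero p)).add (hic.smulRight hic)
  have hα : DifferentiableAt ℝ (fun z => innerSL ℝ v - (inner ℝ v (ρ z) : ℝ) • innerSL ℝ (ρ z))
      (p : Amb n) :=
    (differentiableAt_const _).sub (((differentiableAt_const v).inner ℝ hρ).smul hi)
  obtain ⟨e, he⟩ := exists_equiv_extForm hg p
  have hinv : DifferentiableAt ℝ
      (fun z => ContinuousLinearMap.inverse (extForm (radialExt g z) (ρ z))) (p : Amb n) := by
    have h1 := contDiffAt_map_inverse (𝕜 := ℝ) (n := ∞) e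
    have h2 : (e : Amb n →L[ℝ] Amb n →L[ℝ] ℝ) = extForm (radialExt g p) (ρ p) := by
      simp only [ρ, radialExt_coe]
      exact he
    rw [h2] at h1
    exact (h1.comp (p : Amb n) hB).differentiableAt (by simp)
  refine (hinv.clm_apply hα).congr_of_eventuallyEq ?_
  filter_upwards [isOpen_compl_singleton.mem_nhds (coe_sphere_ne_zero p)] with z hz
  have hz' : z ≠ 0 := hz
  simp only [ρ, radialExt, dif_neg hz']
  set q := radialProj z hz'
  obtain ⟨e', he'⟩ := exists_equiv_extForm hg q
  have hs := gradHeight_spec hg v q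
  have h1 : e' (gradHeight g v q) =
      innerSL ℝ v - (inner ℝ v (q : Amb n) : ℝ) • innerSL ℝ (q : Amb n) := by
    ext y
    have h2 : e' (gradHeight g v q) = extForm (g q) q (gradHeight g v q) := by
      rw [← he']
      rfl
    have h3 := hs.2 _ (inner_tangentProj q y)
    have h4 : g q (gradHeight g v q) (tangentProj q y) = g q (gradHeight g v q) y := by
      simp [tangentProj, hg.1.horizontal_right]
    rw [h2, extForm_apply, hs.1, ← h4, h3]
    simp [tangentProj, inner_sub_right, inner_smul_right]
    ring
  rw [← he', ContinuousLinearMap.inverse_equiv, ← h1]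
  simp

/-- The properties of the unit normal of an equator at a point of the equator. -/
theorem unitNormal_spec {g : BilinField n} (hg : IsRiemannianMetric g) {v : Amb n} (hv : v ≠ 0)
    {p : Sphere n} (hp : inner ℝ v (p : Amb n) = 0) :
    0 < g p (gradHeight g v p) (gradHeight g v p) ∧
    inner ℝ (p : Amb n) (unitNormal g v p) = 0 ∧ g p (unitNormal g v p) (unitNormal g v p) = 1 ∧
      ∀ y, inner ℝ (p : Amb n) y = 0 → (g p (unitNormal g v p) y = 0 ↔ inner ℝ v y = 0) := by
  have hs := gradHeight_spec hg v p
  have hG : gradHeight g v p ≠ 0 := by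
    intro h0
    have h1 := hs.2 v (by rw [real_inner_comm, hp])
    rw [h0, map_zero, zero_apply] at h1
    exact hv (inner_self_eq_zero.mp h1.symm)
  have hpos := hg.2 p _ hs.1 hG
  have hsq := Real.mul_self_sqrt hpos.le
  have hsp := Real.sqrt_pos.mpr hpos
  set s := Real.sqrt (g p (gradHeight g v p) (gradHeight g v p)) with hsdef
  have hN : unitNormal g v p = s⁻¹ • gradHeight g v p := rfl
  refine ⟨hpos, ?_, ?_, fun y hy => ?_⟩
  · rw [hN, inner_smul_right, hs.1, mul_zero]
  · rw [hN]
    simp only [map_smul, smul_apply, smul_eq_mul, ← hsq]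
    field_simp
  · rw [hN, map_smul, smul_apply, hs.2 y hy, smul_eq_mul, mul_eq_zero]
    simp [hsp.ne']

/-- Along the sphere, `g(N, y)` is a multiple of the inner product of `v` with the tangential part
of the fixed vector `y`. Its derivative at `p` in the direction `y` vanishes, so `g(∂_y N, y) =
-(∂_y g)(N, y)`; the Koszul term adds `(∂_N g)(y, y) / 2`. -/
theorem secondFundForm_eq {g : BilinField n} (hg : IsRiemannianMetric g) {v : Amb n} (hv : v ≠ 0)
    {p : Sphere n} (hp : inner ℝ v (p : Amb n) = 0) {y : Amb n} (hy : inner ℝ (p : Amb n) y = 0)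
    (hvy : inner ℝ v y = 0) :
    secondFundForm g v p y y =
      (dirDeriv g p (unitNormal g v p) y y - 2 * dirDeriv g p y y (unitNormal g v p)) / 2 := by
  obtain ⟨hpos, hNp, -, -⟩ := unitNormal_spec hg hv hp
  let ρ : Amb n → Amb n := radialExt fun q : Sphere n => (q : Amb n)
  let a : Sphere n → ℝ := fun q => (Real.sqrt (g q (gradHeight g v q) (gradHeight g v q)))⁻¹
  have hG := differentiableAt_gradHeight hg v p
  have hgd := differentiableAt_radialExt hg.1.smooth p
  have hρ := differentiableAt_radialExt (smoothOnSphere_coe (n := n)) p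
  have ha : DifferentiableAt ℝ (radialExt a) (p : Amb n) := by
    have h1 : radialExt a = fun z => (Real.sqrt (radialExt g z (radialExt (gradHeight g v) z)
        (radialExt (gradHeight g v) z)))⁻¹ := by
      funext z
      by_cases hz : z = 0 <;> simp [radialExt, hz, a]
    have h2 := (hgd.clm_apply hG).clm_apply hG
    rw [h1]
    have h3 : radialExt g (p : Amb n) (radialExt (gradHeight g v) (p : Amb n))
        (radialExt (gradHeight g v) (p : Amb n)) ≠ 0 := by
      simp only [radialExt_coe]
      exact hpos.ne'
    refine (h2.sqrt h3).inv ?_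
    simp only [radialExt_coe]
    exact (Real.sqrt_pos.mpr hpos).ne'
  have hN : DifferentiableAt ℝ (radialExt (unitNormal g v)) (p : Amb n) := by
    have h1 : radialExt (unitNormal g v) = fun z => radialExt a z • radialExt (gradHeight g v) z :=
      radialExt_smul_fun a (gradHeight g v)
    rw [h1]
    exact ha.smul hG
  have hid : (fun z => radialExt g z (radialExt (unitNormal g v) z) y) = fun z => radialExt a z *
      (inner ℝ v y - inner ℝ (ρ z) y * inner ℝ v (ρ z)) := by
    funext z
    by_cases hz : z = 0
    · simp [radialExt, hz]
    · simp only [ρ, radialExt, dif_neg hz]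
      set q := radialProj z hz
      have h1 := (gradHeight_spec hg v q).2 _ (inner_tangentProj q y)
      have h2 : g q (gradHeight g v q) (tangentProj q y) = g q (gradHeight g v q) y := by
        simp [tangentProj, hg.1.horizontal_right]
      rw [h2, tangentProj, inner_sub_right, inner_smul_right] at h1
      rw [unitNormal, map_smul, smul_apply, h1, smul_eq_mul]
  have hL := (hgd.hasFDerivAt.clm_apply hN.hasFDerivAt).clm_apply (hasFDerivAt_const y (p : Amb n))
  have hR : HasFDerivAt (fun z => radialExt a z *
      (inner ℝ v y - inner ℝ (ρ z) y * inner ℝ v (ρ z))) _ (p : Amb n) := ha.hasFDerivAt.mul ((hasFDerivAt_const (inner ℝ v y : ℝ) (p : Amb n)).sub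
    ((hρ.hasFDerivAt.inner ℝ (hasFDerivAt_const y (p : Amb n))).mul
      ((hasFDerivAt_const v (p : Amb n)).inner ℝ hρ.hasFDerivAt)))
  rw [hid] at hL
  have hLR := hL.unique hR
  have hkey : dirDeriv g p y (unitNormal g v p) y + g p (dirDeriv (unitNormal g v) p y) y = 0 := by
    have h1 := congrArg (fun L : Amb n →L[ℝ] ℝ => L y) hLR
    simp [ρ, radialExt_coe, hy, hvy, hp] at h1
    simp only [dirDeriv]
    linarith
  have hc := (connDiff_spec hg p y (unitNormal g v p)).2 y hy
  rw [dirDeriv_symm hg.1 p y (unitNormal g v p) y] at hc hkey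
  have hr : g p (roundConn p y (unitNormal g v)) y = g p (dirDeriv (unitNormal g v) p y) y := by
    simp [roundConn, tangentProj, hg.1.horizontal]
  rw [secondFundForm, leviCivita, map_add, add_apply, hc, hr]
  linarith

end SecondFundForm

/-! ### Minimal equators, Killing tensors and equivariance. -/

section Correspondence

variable {n : ℕ}

/-- The derivative of a two-tensor, as a trilinear form on the tangent space. -/
def tangentDeriv (g : BilinField n) (p : Sphere n) :
    (Submodule.span ℝ {(p : Amb n)})ᗮ →ₗ[ℝ] (Submodule.span ℝ {(p : Amb n)})ᗮ →ₗ[ℝ]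
      (Submodule.span ℝ {(p : Amb n)})ᗮ →ₗ[ℝ] ℝ :=
  LinearMap.mk₂ ℝ (fun x y => (fderiv ℝ (radialExt g) (p : Amb n) x y).toLinearMap.comp
    (Submodule.span ℝ {(p : Amb n)})ᗮ.subtype)
    (fun _ _ _ => by ext; simp) (fun _ _ _ => by ext; simp)
    (fun _ _ _ => by ext; simp) (fun _ _ _ => by ext; simp)

theorem tangentDeriv_apply (g : BilinField n) (p : Sphere n)
    (x y z : (Submodule.span ℝ {(p : Amb n)})ᗮ) :
    tangentDeriv g p x y z = dirDeriv g p x y z := rfl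

/-- The equators through `p` realize all tangent hyperplanes, so the condition at `p` can be stated
with an arbitrary `g`-unit normal. -/
theorem minimal_iff_frames {g : BilinField n} (hg : IsRiemannianMetric g) (p : Sphere n) :
    (∀ v : Amb n, v ≠ 0 → inner ℝ v (p : Amb n) = 0 → ∀ e : Fin (n - 1) → Amb n,
      (∀ i, inner ℝ (p : Amb n) (e i) = 0 ∧ inner ℝ v (e i) = 0) →
      (∀ i j, g p (e i) (e j) = if i = j then 1 else 0) →
      ∑ i, secondFundForm g v p (e i) (e i) = 0) ↔
    (∀ (ν : (Submodule.span ℝ {(p : Amb n)})ᗮ)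
      (e : Fin (n - 1) → (Submodule.span ℝ {(p : Amb n)})ᗮ), tangentForm g p ν ν = 1 →
      (∀ i j, tangentForm g p (e i) (e j) = if i = j then 1 else 0) →
      (∀ i, tangentForm g p ν (e i) = 0) →
      ∑ i, (tangentDeriv g p ν (e i) (e i) - 2 * tangentDeriv g p (e i) (e i) ν) = 0) := by
  have hsum : ∀ {v : Amb n}, v ≠ 0 → inner ℝ v (p : Amb n) = 0 → ∀ e : Fin (n - 1) → Amb n,
      (∀ i, inner ℝ (p : Amb n) (e i) = 0 ∧ inner ℝ v (e i) = 0) →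
      ∑ i, secondFundForm g v p (e i) (e i) =
        (∑ i, (dirDeriv g p (unitNormal g v p) (e i) (e i) -
          2 * dirDeriv g p (e i) (e i) (unitNormal g v p))) / 2 := by
    intro v hv hp e he
    rw [Finset.sum_div]
    exact Finset.sum_congr rfl fun i _ => secondFundForm_eq hg hv hp (he i).1 (he i).2
  constructor
  · intro h ν e hν he hνe
    -- With `v` dual to `g(ν, ·)`, the gradient of the height function at `p` is `ν`, already of
    -- unit length.
    let v : Amb n := (InnerProductSpace.toDual ℝ (Amb n)).symm (g p ν)
    have hv : ∀ y, inner ℝ v y = g p ν y := fun y => InnerProductSpace.toDual_symm_apply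
    have hνp := mem_tangent.mp ν.2
    have hν1 : g p ν ν = 1 := hν
    have hv0 : v ≠ 0 := by
      intro h0
      have h1 := hv ν
      rw [h0, inner_zero_left, hν1] at h1
      exact one_ne_zero h1.symm
    have hvp : inner ℝ v (p : Amb n) = 0 := by rw [hv, hg.1.horizontal_right]
    have hs := gradHeight_spec hg v p
    have hgrad : gradHeight g v p = ν :=
      tangent_ext hg hs.1 hνp fun z hz => by rw [hs.2 z hz, hv]
    have hN : unitNormal g v p = ν := by
      rw [unitNormal, hgrad, hν1, Real.sqrt_one, inv_one, one_smul]
    have he' : ∀ i, inner ℝ (p : Amb n) (e i : Amb n) = 0 ∧ inner ℝ v (e i : Amb n) = 0 :=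
      fun i => ⟨mem_tangent.mp (e i).2, by rw [hv]; exact hνe i⟩
    have h1 := h v hv0 hvp (fun i => e i) he' he
    rw [hsum hv0 hvp _ he', hN] at h1
    simp only [tangentDeriv_apply]
    linarith
  · intro h v hv hp e he heg
    obtain ⟨-, h1, h2, h3⟩ := unitNormal_spec hg hv hp
    rw [hsum hv hp e he]
    have h4 := h ⟨unitNormal g v p, mem_tangent.mpr h1⟩
      (fun i => ⟨e i, mem_tangent.mpr (he i).1⟩) h2 heg fun i => (h3 _ (he i).1).mpr (he i).2
    simp only [tangentDeriv_apply] at h4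
    rw [h4, zero_div]

theorem minimal_iff_cubic (hn : 2 ≤ n) {g : BilinField n} (hg : IsRiemannianMetric g) :
    (∀ v : Amb n, v ≠ 0 → IsMinimalEquator g v) ↔
    ∀ (p : Sphere n) (x : Amb n), inner ℝ (p : Amb n) x = 0 →
      (n + 1) * dirDeriv g p x x x = 2 * ((gramDet g p)⁻¹ * dirDeriv (gramDet g) p x) * g p x x := by
  have key : ∀ p : Sphere n, _ := fun p => cubic_iff_of_bilin_frames (n := n) (by omega)
    (finrank_tangent p) (tangentForm g p) (fun x y => hg.1.symm p x y) (tangentForm_pos hg.2 p)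
    (C := tangentDeriv g p) (fun x y z => dirDeriv_symm hg.1 p x y z)
    -- The trace `τ` of the derivative of `g` is the differential of the logarithm of `gramDet g`.
    (τ := (gramDet g p)⁻¹ • (fderiv ℝ (radialExt (gramDet g)) (p : Amb n)).toLinearMap.comp
      (Submodule.span ℝ {(p : Amb n)})ᗮ.subtype) (by
        intro b hb x
        have h1 := dirDeriv_gramDet hg.1 (p := p) (f := fun i => (b i : Amb n))
          (fun i => mem_tangent.mp (b i).2) hb x
        have h2 := gramDet_pos hg.1 hg.2 p
        simp only [LinearMap.smul_apply, smul_eq_mul, tangentDeriv_apply]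
        change (gramDet g p)⁻¹ * dirDeriv (gramDet g) p x = _
        rw [h1, inv_mul_cancel_left₀ h2.ne'])
  constructor
  · intro h p x hx
    have h1 := (minimal_iff_frames hg p).mp fun v hv hp => h v hv p hp
    exact (key p).mp h1 ⟨x, mem_tangent.mpr hx⟩
  · intro h v hv p hp
    exact (minimal_iff_frames hg p).mpr ((key p).mpr fun x => h p x (mem_tangent.mp x.2)) v hv hp

theorem dirDeriv_smul {F : Type*} [NormedAddCommGroup F] [NormedSpace ℝ F] {c : Sphere n → ℝ}
    {f : Sphere n → F} {p : Sphere n} {c' : Amb n →L[ℝ] ℝ}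
    (hc : HasFDerivAt (radialExt c) c' (p : Amb n))
    (hf : DifferentiableAt ℝ (radialExt f) (p : Amb n)) (x : Amb n) :
    dirDeriv (fun q => c q • f q) p x = c p • dirDeriv f p x + c' x • f p := by
  have hd : HasFDerivAt (fun z => radialExt c z • radialExt f z) _ (p : Amb n) :=
    hc.smul hf.hasFDerivAt
  rw [dirDeriv, radialExt_smul_fun, hd.fderiv]
  simp [radialExt_coe, dirDeriv]

theorem minimal_iff_killing (hn : 2 ≤ n) {g : BilinField n} (hg : IsRiemannianMetric g) :
    (∀ v : Amb n, v ≠ 0 → IsMinimalEquator g v) ↔ IsConstAlongGeodesics (toKilling g) := by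
  rw [minimal_iff_cubic hn hg, isConstAlongGeodesics_iff (isRiemannianMetric_toKilling hg).1]
  refine forall_congr' fun p => forall_congr' fun x => imp_congr_right fun _ => ?_
  have hn0 : (n : ℝ) + 1 ≠ 0 := by positivity
  have hpos := gramDet_pos hg.1 hg.2
  -- The density is the square root of `gramDet`, so `1 / F_g`, its power `-4/(n+1)`, is `gramDet g
  -- ^ r`.
  let r : ℝ := -(2 / ((n : ℝ) + 1))
  let c : Sphere n → ℝ := fun q => gramDet g q ^ r
  have hk : toKilling g = fun q => c q • g q := by
    funext q
    simp only [toKilling, metricFactor, c, r]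
    rw [volDensity_eq hg.1.horizontal, Real.sqrt_eq_rpow, ← Real.rpow_mul (hpos q).le,
      ← Real.rpow_neg (hpos q).le]
    congr 2
    ring
  have hV := smoothOnSphere_gramDet hg.1.smooth
  have hVp := hV.hasFDerivAt p
  have hcx : HasFDerivAt (radialExt c) ((r * gramDet g p ^ (r - 1)) •
      fderiv ℝ (radialExt (gramDet g)) (p : Amb n)) (p : Amb n) := by
    have h1 : radialExt (gramDet g) (p : Amb n) ≠ 0 := by
      rw [radialExt_coe]
      exact (hpos p).ne'
    have h2 := hVp.rpow_const (p := r) (Or.inl h1)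
    rw [radialExt_coe] at h2
    refine h2.congr_of_eventuallyEq ?_
    filter_upwards [isOpen_compl_singleton.mem_nhds (coe_sphere_ne_zero p)] with z hz
    have hz' : z ≠ 0 := hz
    simp only [radialExt, dif_neg hz', c]
  have hD : dirDeriv (toKilling g) p x x x = c p * dirDeriv g p x x x +
      r * gramDet g p ^ (r - 1) * dirDeriv (gramDet g) p x * g p x x := by
    rw [hk, dirDeriv_smul hcx (differentiableAt_radialExt hg.1.smooth p)]
    simp [dirDeriv]
  have hc0 : 0 < gramDet g p ^ r := Real.rpow_pos_of_pos (hpos p) r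
  -- The defect in the Killing equation is a positive multiple of the defect in the cubic identity.
  have hfac : (n + 1) * dirDeriv (toKilling g) p x x x = gramDet g p ^ r *
      ((n + 1) * dirDeriv g p x x x -
        2 * ((gramDet g p)⁻¹ * dirDeriv (gramDet g) p x) * g p x x) := by
    rw [hD, Real.rpow_sub_one (hpos p).ne']
    simp only [c]
    have hr : (n + 1 : ℝ) * r = -2 := by
      simp only [r]
      field_simp
    linear_combination (gramDet g p ^ r / gramDet g p * dirDeriv (gramDet g) p x * g p x x) * hr
  rw [← sub_eq_zero]
  constructor
  · intro h
    rw [h, mul_zero] at hfac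
    exact (mul_eq_zero.mp hfac).resolve_left hn0
  · intro h
    rw [h, mul_zero] at hfac
    exact (mul_eq_zero.mp hfac.symm).resolve_left hc0.ne'

theorem toKilling_mem (hn : 2 ≤ n) {g : BilinField n} (hg : g ∈ minimalEquatorMetrics n) :
    toKilling g ∈ posKillingTensors n :=
  ⟨⟨(isRiemannianMetric_toKilling hg.1).1, (minimal_iff_killing hn hg.1).mp hg.2⟩,
    (isRiemannianMetric_toKilling hg.1).2⟩

theorem toMetric_mem (hn : 2 ≤ n) {k : BilinField n} (hk : k ∈ posKillingTensors n) :
    toMetric k ∈ minimalEquatorMetrics n := by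
  have hkm : IsRiemannianMetric k := ⟨hk.1.1, hk.2⟩
  have hm := isRiemannianMetric_toMetric hkm
  refine ⟨hm, (minimal_iff_killing hn hm).mpr ?_⟩
  rw [toKilling_toMetric hn (volDensity_pos hkm.1 hkm.2)]
  exact hk.1.2

/-- The correspondence between metrics with minimal equators and positive Killing tensors. -/
def metricEquivKilling (hn : 2 ≤ n) : minimalEquatorMetrics n ≃ posKillingTensors n where
  toFun g := ⟨toKilling g, toKilling_mem hn g.2⟩
  invFun k := ⟨toMetric k, toMetric_mem hn k.2⟩
  left_inv g := Subtype.ext (toMetric_toKilling hn (volDensity_pos g.2.1.1 g.2.1.2))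
  right_inv k := Subtype.ext (toKilling_toMetric hn (volDensity_pos k.2.1.1 k.2.2))

theorem tensorAct_mem_pos (T : GLn n) {k : BilinField n} (hk : k ∈ posKillingTensors n) :
    tensorAct T k ∈ posKillingTensors n :=
  ⟨tensorAct_mem T hk.1, isPosDef_tensorAct T hk.1.1 hk.2⟩

theorem pullback_phi_mem (hn : 2 ≤ n) (T : GLn n) {g : BilinField n}
    (hg : g ∈ minimalEquatorMetrics n) : pullback (phi T) g ∈ minimalEquatorMetrics n := by
  rw [← toMetric_tensorAct hn hg.1]
  exact toMetric_mem hn (tensorAct_mem_pos T (toKilling_mem hn hg))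

/-- The action of the general linear group on metrics with minimal equators. -/
def metricAct (hn : 2 ≤ n) (T : GLn n) (g : minimalEquatorMetrics n) : minimalEquatorMetrics n :=
  ⟨pullback (phi T) g, pullback_phi_mem hn T g.2⟩

theorem metricEquivKilling_metricAct (hn : 2 ≤ n) (T : GLn n) (g : minimalEquatorMetrics n) :
    (metricEquivKilling hn (metricAct hn T g) : BilinField n) =
      killingAct T ⟨(metricEquivKilling hn g : BilinField n), (metricEquivKilling hn g).2.1⟩ :=
  toKilling_pullback_phi g.2.1 T

end Correspondence

end Equators

end

theorem mainTheorem4 (n : ℕ) (hn : 2 ≤ n) :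
    ∃ Φ : minimalEquatorMetrics n ≃ posKillingTensors n,
      (∀ g, (Φ g : BilinField n) = toKilling (g : BilinField n)) ∧
      (∀ k, (Φ.symm k : BilinField n) = toMetric (k : BilinField n)) ∧
      ∃ (actE : GLn n → minimalEquatorMetrics n → minimalEquatorMetrics n)
        (actK : GLn n → (killingTensors n →ₗ[ℝ] killingTensors n)),
        (∀ T g, (actE T g : BilinField n) = pullback (phi T) (g : BilinField n)) ∧
        (∀ g, actE 1 g = g) ∧
        (∀ S T g, actE T (actE S g) = actE (S * T) g) ∧
        (∀ T V W, actK T (killingProd V W) = killingProd (soAct V T) (soAct W T)) ∧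
        (∀ T (A : killingTensors n →ₗ[ℝ] killingTensors n),
          (∀ V W, A (killingProd V W) = killingProd (soAct V T) (soAct W T)) → A = actK T) ∧
        (∀ k, actK 1 k = k) ∧
        (∀ S T k, actK T (actK S k) = actK (S * T) k) ∧
        (∀ T (k : killingTensors n), IsPosDef (k : BilinField n) → IsPosDef (actK T k : BilinField n)) ∧
        ∀ T g, (Φ (actE T g) : BilinField n) =
          actK T ⟨(Φ g : BilinField n), (Φ g).2.1⟩ := by
  have equi := metricEquivKilling_metricAct hn
  refine ⟨metricEquivKilling hn, fun _ => rfl, fun _ => rfl, metricAct hn, killingAct,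
    fun _ _ => rfl, fun g => ?_, fun S T g => ?_, killingAct_killingProd,
    fun T A hA => killing_linearMap_ext fun V W => (hA V W).trans (killingAct_killingProd T V W).symm,
    killingAct_one, killingAct_mul, fun T k hk => isPosDef_tensorAct T k.2.1 hk, equi⟩
  -- Both action laws for metrics are pulled back from those for Killing tensors through the
  -- injective equivariant correspondence, so no chain rule for `φ` is needed.
  · refine (metricEquivKilling hn).injective (Subtype.ext ?_)
    rw [equi, killingAct_one]
  · refine (metricEquivKilling hn).injective (Subtype.ext ?_)
    refine (equi T _).trans ((congrArg (fun k => (killingAct T k : BilinField n))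
      (Subtype.ext (equi S g))).trans ?_)
    rw [killingAct_mul]
    exact (equi (S * T) g).symm
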